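/- Consider a stochastic bandit game with a finite set of arms $\mathcal{A}$, where arm $b\in\mathcal{A}$ has a distribution $\nu_b$ over $[0,1]$ with expectation $\mu_b$. At each round $t\ge 1$ the player picks an arm $A_t$, on the basis of the past payoffs and possibly of auxiliary randomization, and receives a payoff $Y_t$ drawn according to $\nu_{A_t}$. Let $N_t(b)$ be the number of rounds $s\le t$ with $A_s=b$, and let $\hat\nu_{b,t}=\frac{1}{N_t(b)}\sum_{s\le t,\,A_s=b}\delta_{Y_s}$ be the empirical distribution of the payoffs of arm $b$. For a finitely supported distribution $\nu$ over $[0,1]$ and $\mu\in[0,1)$ let \[ \mathcal{K}_{\inf}(\nu,\mu)=\inf\bigl\{\mathcal{K}(\nu,\nu') : \nu' \text{ a finitely supported distribution over } [0,1] \text{ with expectation } E(\nu')>\mu\bigr\}, \] where $\mathcal{K}$ is the Kullback-Leibler divergence (for $\mu=1$ the infimum is $+\infty$). The $\mathcal{K}_{\inf}$-strategy run with $f(t)=\log t$ pulls each arm once during the first $|\mathcal{A}|$ rounds and then, at each round $t+1$ with $t\ge|\mathcal{A}|$, pulls an arm $b$ with maximal index \[ B^+_{b,t}=\sup\bigl\{q\in[0,1]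 : N_t(b)\,\mathcal{K}_{\inf}(\hat\nu_{b,t},q)\le \log t\bigr\}, \] in case of a tie an arm with largest empirical average $E(\hat\nu_{b,t})$ among those with maximal index. Let $a^\star$ be an optimal arm, with finitely supported distribution $\nu^\star=\nu_{a^\star}$, expectation $\mu^\star=\max_b\mu_b\in(0,1)$ and support $\mathcal{S}^\star$. Let $a\in\mathcal{A}$ be a suboptimal arm such that $\mu_a>0$ and $\nu_a$ is finitely supported, and let $\Delta_a=\mu^\star-\mu_a>0$. Then for all $c_a>0$, all \[ 0<\epsilon<\min\Bigl\{\Delta_a,\ \frac{c_a/2}{1+c_a}\,(1-\mu^\star)\,\mathcal{K}_{\inf}(\nu_a,\mu^\star)\Bigr\} \] and all $T\ge 1$, the $\mathcal{K}_{\inf}$-strategy run with $f=\log$ satisfies \[ \mathbb{E}[N_T(a)]\le 1+\frac{(1+c_a)\log T}{\mathcal{K}_{\inf}(\nu_a,\mu^\star)}+\frac{1}{1-e^{-\Theta_a(c_a,\epsilon)}}+\frac{1}{\epsilon^2}\log\Bigl(\frac{1}{1-\mu^\star+\epsilon}\Bigr)\sum_{k=1}^{T}(k+1)^{|\mathcal{S}^\star|}e^{-k\epsilon^2}+\frac{1}{(\Delta_a-\epsilon)^2},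 \] where \[ \Theta_a(c_a,\epsilon)=\theta_a\Bigl(\frac{\log T}{k_0}+\frac{\epsilon}{1-\mu^\star}\Bigr)\in(0,+\infty],\qquad k_0=\Bigl\lceil\frac{(1+c_a)\log T}{\mathcal{K}_{\inf}(\nu_a,\mu^\star)}\Bigr\rceil \] (for $T=1$ the quotient $\log T/k_0$ is read as $0$, and $e^{-\infty}=0$), and, for all $\gamma>0$, \[ \theta_a(\gamma)=\inf\bigl\{\mathcal{K}(\nu',\nu_a) : \nu' \text{ a finitely supported distribution over } [0,1] \text{ with } \mathcal{K}_{\inf}(\nu',\mu^\star)<\gamma\bigr\}\in[0,+\infty]. \] -/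

import Mathlib

open MeasureTheory ProbabilityTheory InformationTheory
open scoped ENNReal

noncomputable section

namespace KinfBandit

/-- `ν` is a probability distribution over `[0,1]` (seen as a measure on `ℝ`). -/
structure IsUnitDist (ν : Measure ℝ) : Prop where
  isProb : IsProbabilityMeasure ν
  compl_eq_zero : ν (Set.Icc (0 : ℝ) 1)ᶜ = 0

/-- `ν` is a finitely supported probability distribution over `[0,1]`. -/
structure IsFinUnitDist (ν : Measure ℝ) : Prop extends IsUnitDist ν where
  finite_support : ν.support.Finite

/-- The expectation `E(ν)`. -/
def mean (ν : Measure ℝ) : ℝ := ∫ x, x ∂ν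

/-- `K_inf(ν, μ)`: the infimum of the Kullback-Leibler divergences `K(ν, ν')` over the finitely
supported distributions `ν'` over `[0,1]` whose expectation is larger than `μ`. -/
def kInf (ν : Measure ℝ) (μ : ℝ) : ℝ≥0∞ :=
  sInf {r | ∃ ν' : Measure ℝ, IsFinUnitDist ν' ∧ μ < mean ν' ∧ r = klDiv ν ν'}

/-- `θ_a(γ)`, for `νa` the distribution of arm `a` and `μs` the optimal expectation: the infimum of
the `K(ν', νa)` over the finitely supported distributions `ν'` over `[0,1]` with
`K_inf(ν', μs) < γ`. It is `∞` when there is no `ν'` with finite divergence. -/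
def theta (νa : Measure ℝ) (μs γ : ℝ) : ℝ≥0∞ :=
  sInf {r | ∃ ν' : Measure ℝ, IsFinUnitDist ν' ∧ kInf ν' μs < ENNReal.ofReal γ ∧ r = klDiv ν' νa}

/-- `k₀ = ⌈(1 + c) log T / K_inf(νa, μs)⌉`. -/
def kZero (νa : Measure ℝ) (μs c : ℝ) (T : ℕ) : ℕ :=
  ⌈(1 + c) * Real.log T / (kInf νa μs).toReal⌉₊

/-- `Θ_a(c, ε) = θ_a(log T / k₀ + ε / (1 - μs))`. -/
def bigTheta (νa : Measure ℝ) (μs c ε : ℝ) (T : ℕ) : ℝ≥0∞ :=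
  theta νa μs (Real.log T / (kZero νa μs c T : ℝ) + ε / (1 - μs))

section Game

variable {Ω : Type*} {𝒜 : Type*} [DecidableEq 𝒜]

/-- The rounds among `1, …, t` at which arm `a` is pulled. -/
def pulls (A : ℕ → Ω → 𝒜) (a : 𝒜) (t : ℕ) (ω : Ω) : Finset ℕ :=
  (Finset.Icc 1 t).filter (fun s => A s ω = a)

/-- `N_t(a)`, the number of times arm `a` is pulled between the rounds `1` and `t`. -/
def numPulls (A : ℕ → Ω → 𝒜) (a : 𝒜) (t : ℕ) (ω : Ω) : ℕ := (pulls A a t ω).card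

/-- The empirical distribution of the payoffs obtained till round `t` when pulling arm `a`. -/
def empDist (A : ℕ → Ω → 𝒜) (Y : ℕ → Ω → ℝ) (a : 𝒜) (t : ℕ) (ω : Ω) : Measure ℝ :=
  (numPulls A a t ω : ℝ≥0∞)⁻¹ • ∑ s ∈ pulls A a t ω, Measure.dirac (Y s ω)

/-- The index `B⁺_{a,t}`, the largest `q ∈ [0,1]` with `N_t(a) K_inf(empDist, q) ≤ f(t)`. It is
written as a supremum: `kInf ν 1` is an infimum over the empty set, hence `∞`, so that for an
empirical distribution equal to `δ_1` the index is `1` while `q = 1` is not in the set. -/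
def index (f : ℕ → ℝ) (A : ℕ → Ω → 𝒜) (Y : ℕ → Ω → ℝ) (a : 𝒜) (t : ℕ) (ω : Ω) : ℝ :=
  sSup {q : ℝ | q ∈ Set.Icc (0 : ℝ) 1 ∧
    (((numPulls A a t ω : ℝ≥0∞) * kInf (empDist A Y a t ω) q : ℝ≥0∞) : EReal) ≤ (f t : EReal)}

/-- The stochastic bandit game with arm distributions `ν`: `A t` is the arm picked at round `t ≥ 1`
and `Y t` the payoff received. The σ-algebra `ℱ t` is the information available to the player just
before the payoff of round `t + 1` is drawn: the past payoffs, the auxiliary randomizations of the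
player, and the choice `A (t + 1)`. Given `ℱ t`, the payoff `Y (t + 1)` has law `ν (A (t + 1))`. -/
structure IsBanditGame [mΩ : MeasurableSpace Ω] (P : Measure Ω) (ν : 𝒜 → Measure ℝ)
    (ℱ : Filtration ℕ mΩ) (A : ℕ → Ω → 𝒜) (Y : ℕ → Ω → ℝ) : Prop where
  measurable_payoff : ∀ t, 1 ≤ t → Measurable[ℱ t] (Y t)
  measurable_choice : ∀ t a, MeasurableSet[ℱ t] {ω | A (t + 1) ω = a}
  cond_law : ∀ t (B : Set ℝ), MeasurableSet B →
    P[(Y (t + 1) ⁻¹' B).indicator (fun _ => (1 : ℝ)) | ℱ t]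
      =ᵐ[P] fun ω => (ν (A (t + 1) ω)).real B

/-- Almost surely, the arms are chosen according to the `K_inf`-strategy run with `f`: each arm is
pulled once in the first `|𝒜|` rounds; then `A (t + 1)` maximizes the index, and among the arms
with maximal index it has the largest empirical average. -/
def FollowsKinf [MeasurableSpace Ω] [Fintype 𝒜] (P : Measure Ω) (f : ℕ → ℝ)
    (A : ℕ → Ω → 𝒜) (Y : ℕ → Ω → ℝ) : Prop :=
  ∀ᵐ ω ∂P, (∀ b, numPulls A b (Fintype.card 𝒜) ω = 1) ∧
    ∀ t, Fintype.card 𝒜 ≤ t →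
      (∀ b, index f A Y b t ω ≤ index f A Y (A (t + 1) ω) t ω) ∧
      (∀ b, index f A Y b t ω = index f A Y (A (t + 1) ω) t ω →
        mean (empDist A Y b t ω) ≤ mean (empDist A Y (A (t + 1) ω) t ω))

end Game

end KinfBandit

end

/-!
The whole argument stays on the primal side of `kInf`: competitors are modified by mixing, and no
dual formula for `kInf` is used. Write `q = μs - ε` for the level at which indices are compared.

*Pathwise bound* (`numPulls_le_add_sums`). After `k₀` pulls of arm `a`, every further pull at a
round `t + 1` falls into one of two cases. Either the index of the optimal arm is at least `q`,
hence so is the index of `a`; as `kInf` is nondecreasing and regular in its second argument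
(`kInf_le_add`), `kInf` of the empirical distribution of `a` at `μs` is then less than
`γ = log T / k₀ + ε / (1 - μs)`. Or `log t < k kInf(ν̂, q)`, where `ν̂` is the empirical
distribution of the optimal arm after `k` pulls; for given `k` this holds for at most
`exp (k kInf(ν̂, q))` rounds.

*Change of measure* (`IsBanditGame.likelihoodDominated`). For `r ≥ 0` with `∫ r dν_b = 1`, the
product of `r(Y s)` over the first `k` pulls of arm `b`, stopped at round `t`, is a martingale with
expectation `1`. This replaces the independence of the payoffs, as the number of pulls is random.
A well chosen `r` bounds the probability that the empirical distribution equals a given type `n / k`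
by `exp (-k KL(n / k, ν_b))`, and the probability that it lies in the convex set
`{ν' | kInf ν' μs < γ}` by `exp (-k θ(γ))`, without the polynomial factor of Sanov's theorem
(`LikelihoodDominated.sum_le_exp_theta`).

*Conclusion.* The first case contributes a geometric series. In the second one, the types that
matter have expectation at most `q`, and they satisfy
`kInf(n / k, q) + ε² ≤ KL(n / k, ν_{a⋆})` by mixing `ν_{a⋆}` with the type and using
Pinsker's inequality (`kInf_add_sq_le_klDiv`); as there are at most `(k + 1)^|S⋆|` types, the sum
over `k` of `(k + 1)^|S⋆| exp (-k ε²)` appears. Its factor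
`ε⁻² log (1 / (1 - q))` is at least `1`, since the assumption on `ε` forces `ε < μs / 2`.
Positivity of `Θ` (`theta_pos`) holds because `γ < kInf ν_a μs`.
-/

namespace KinfBandit

/-! ### Finitely supported distributions and their divergences -/

/-- The measure with mass `w y` at each point `y` of the finite set `S`. Negative weights count
as `0`, so that the definition is only meaningful for weights that are nonnegative on `S`. -/
noncomputable def discrete (S : Finset ℝ) (w : ℝ → ℝ) : Measure ℝ :=
  ∑ y ∈ S, ENNReal.ofReal (w y) • Measure.dirac y

lemma discrete_apply (S : Finset ℝ) (w : ℝ → ℝ) (B : Set ℝ) [DecidablePred (· ∈ B)] :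
    discrete S w B = ∑ y ∈ S, if y ∈ B then ENNReal.ofReal (w y) else 0 := by
  simp only [discrete, Measure.finsetSum_apply, Measure.smul_apply, smul_eq_mul]
  refine Finset.sum_congr rfl fun y _ => ?_
  rw [Measure.dirac_apply]
  by_cases h : y ∈ B <;> simp [h]

lemma discrete_singleton {S : Finset ℝ} (w : ℝ → ℝ) {y : ℝ} (hy : y ∈ S) :
    discrete S w {y} = ENNReal.ofReal (w y) := by
  classical
  rw [discrete_apply]
  simp [Finset.sum_ite_eq', hy]

lemma discrete_real_singleton {S : Finset ℝ} {w : ℝ → ℝ} {y : ℝ} (hy : y ∈ S) (h : 0 ≤ w y) :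
    (discrete S w).real {y} = w y := by
  rw [Measure.real, discrete_singleton w hy, ENNReal.toReal_ofReal h]

lemma discrete_compl (S : Finset ℝ) (w : ℝ → ℝ) : discrete S w (S : Set ℝ)ᶜ = 0 := by
  classical
  rw [discrete_apply]
  refine Finset.sum_eq_zero fun y hy => ?_
  simp [hy]

lemma ext_of_finset {S : Finset ℝ} {μ ν : Measure ℝ} (hμ : μ (S : Set ℝ)ᶜ = 0)
    (hν : ν (S : Set ℝ)ᶜ = 0) (h : ∀ y ∈ S, μ {y} = ν {y}) : μ = ν := by
  classical
  ext B _
  have key : ∀ ρ : Measure ℝ, ρ (S : Set ℝ)ᶜ = 0 → ρ B = ∑ y ∈ S, ρ {y} * B.indicator 1 y := by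
    intro ρ hρ
    have h1 : ρ = ρ.restrict S := (Measure.restrict_eq_self_of_ae_mem (mem_ae_iff.2 hρ)).symm
    conv_lhs => rw [h1, Measure.restrict_apply' S.measurableSet]
    have h2 : B ∩ (S : Set ℝ) = ((S.filter (· ∈ B) : Finset ℝ) : Set ℝ) := by
      ext x; simp [and_comm]
    rw [h2, ← sum_measure_singleton, Finset.sum_filter]
    refine Finset.sum_congr rfl fun y _ => ?_
    by_cases hy : y ∈ B <;> simp [hy]
  rw [key μ hμ, key ν hν]
  exact Finset.sum_congr rfl fun y hy => by rw [h y hy]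

lemma integral_eq_sum {S : Finset ℝ} {μ : Measure ℝ} [IsFiniteMeasure μ]
    (hμ : μ (S : Set ℝ)ᶜ = 0) (f : ℝ → ℝ) : ∫ x, f x ∂μ = ∑ y ∈ S, μ.real {y} * f y := by
  have h1 : μ = μ.restrict S := (Measure.restrict_eq_self_of_ae_mem (mem_ae_iff.2 hμ)).symm
  conv_lhs => rw [h1]
  rw [setIntegral_finset]
  · rfl
  · exact IntegrableOn.finset

lemma integrable_of_finset {S : Finset ℝ} {μ : Measure ℝ} [IsFiniteMeasure μ]
    (hμ : μ (S : Set ℝ)ᶜ = 0) (f : ℝ → ℝ) : Integrable f μ := by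
  have h1 : μ = μ.restrict S := (Measure.restrict_eq_self_of_ae_mem (mem_ae_iff.2 hμ)).symm
  rw [h1]
  exact IntegrableOn.finset

lemma sum_real_singleton {S : Finset ℝ} {μ : Measure ℝ} [IsProbabilityMeasure μ]
    (hμ : μ (S : Set ℝ)ᶜ = 0) : ∑ y ∈ S, μ.real {y} = 1 := by
  have h := integral_eq_sum hμ (fun _ => (1 : ℝ))
  simpa using h.symm

lemma IsUnitDist.support_subset {ν : Measure ℝ} (hν : IsUnitDist ν) :
    ν.support ⊆ Set.Icc (0 : ℝ) 1 :=
  Measure.support_subset_of_isClosed isClosed_Icc (mem_ae_iff.2 hν.compl_eq_zero)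

lemma IsFinUnitDist.exists_finset {ν : Measure ℝ} (hν : IsFinUnitDist ν) :
    ∃ S : Finset ℝ, (∀ y ∈ S, y ∈ Set.Icc (0 : ℝ) 1) ∧ ν (S : Set ℝ)ᶜ = 0 :=
  ⟨hν.finite_support.toFinset, fun _ hy => hν.support_subset (by simpa using hy), by simp⟩

lemma isFinUnitDist_of_finset {S : Finset ℝ} {ν : Measure ℝ} [IsProbabilityMeasure ν]
    (hS : ∀ y ∈ S, y ∈ Set.Icc (0 : ℝ) 1) (hν : ν (S : Set ℝ)ᶜ = 0) : IsFinUnitDist ν where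
  isProb := inferInstance
  compl_eq_zero := measure_mono_null (Set.compl_subset_compl.2 fun y hy => hS y hy) hν
  finite_support := S.finite_toSet.subset
    (Measure.support_subset_of_isClosed S.finite_toSet.isClosed (mem_ae_iff.2 hν))

lemma isProbabilityMeasure_discrete {S : Finset ℝ} {w : ℝ → ℝ} (hw : ∀ y ∈ S, 0 ≤ w y)
    (hw1 : ∑ y ∈ S, w y = 1) : IsProbabilityMeasure (discrete S w) := by
  classical
  refine ⟨?_⟩
  rw [discrete_apply]
  simp only [Set.mem_univ, if_true]
  rw [← ENNReal.ofReal_sum_of_nonneg hw, hw1, ENNReal.ofReal_one]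

/-- On a finite set carrying `μ`, the divergence is the sum `∑ μ(y) log (μ(y) / ν(y))`. -/
lemma klDiv_eq_sum {S : Finset ℝ} {μ ν : Measure ℝ} [IsProbabilityMeasure μ]
    [IsProbabilityMeasure ν] (hμ : μ (S : Set ℝ)ᶜ = 0)
    (hac : ∀ y ∈ S, ν.real {y} = 0 → μ.real {y} = 0) :
    klDiv μ ν ≠ ∞ ∧
      (klDiv μ ν).toReal = ∑ y ∈ S, μ.real {y} * Real.log (μ.real {y} / ν.real {y}) := by
  have hμν : μ ≪ ν := by
    classical
    refine Measure.AbsolutelyContinuous.mk fun B _ hB => ?_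
    have h2 : B ⊆ (S : Set ℝ)ᶜ ∪ ((S.filter (· ∈ B) : Finset ℝ) : Set ℝ) := by
      intro x hx
      by_cases hxS : x ∈ S <;> simp [hxS, hx]
    refine measure_mono_null h2 (measure_union_null hμ ?_)
    rw [← sum_measure_singleton]
    refine Finset.sum_eq_zero fun y hy => ?_
    obtain ⟨hyS, hyB⟩ := Finset.mem_filter.1 hy
    have h3 : ν {y} = 0 := measure_mono_null (Set.singleton_subset_iff.2 hyB) hB
    have := hac y hyS (by simp [Measure.real, h3])
    rwa [Measure.real, ENNReal.toReal_eq_zero_iff, or_iff_left (measure_ne_top _ _)] at this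
  refine ⟨klDiv_ne_top hμν (integrable_of_finset hμ _), ?_⟩
  rw [toReal_klDiv_of_measure_eq hμν (by simp), integral_eq_sum hμ]
  refine Finset.sum_congr rfl fun y hy => ?_
  by_cases h0 : ν.real {y} = 0
  · simp [hac y hy h0]
  congr 1
  have h1 := Measure.setLIntegral_rnDeriv hμν {y}
  rw [lintegral_singleton] at h1
  rw [llr]
  congr 1
  rw [eq_div_iff h0, Measure.real, Measure.real, ← ENNReal.toReal_mul, h1]

lemma real_eq_zero_of_klDiv_ne_top {μ ν : Measure ℝ} [IsFiniteMeasure μ] [IsFiniteMeasure ν]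
    (h : klDiv μ ν ≠ ∞) (y : ℝ) (hy : ν.real {y} = 0) : μ.real {y} = 0 := by
  rw [Measure.real, ENNReal.toReal_eq_zero_iff, or_iff_left (measure_ne_top _ _)] at hy ⊢
  exact (klDiv_ne_top_iff.1 h).1 hy

/-- The log-sum inequality for two terms. -/
lemma log_sum_le {a b c d : ℝ} (ha : 0 ≤ a) (hb : 0 ≤ b) (hc : 0 ≤ c) (hd : 0 ≤ d)
    (hca : c = 0 → a = 0) (hdb : d = 0 → b = 0) :
    (a + b) * Real.log ((a + b) / (c + d)) ≤ a * Real.log (a / c) + b * Real.log (b / d) := by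
  -- `x log (x / y) ≥ x log r + x - r y` for every `r > 0`
  have key : ∀ x y r : ℝ, 0 ≤ x → 0 ≤ y → 0 < r → (y = 0 → x = 0) →
      x * Real.log r + x - r * y ≤ x * Real.log (x / y) := by
    intro x y r hx hy hr hxy
    rcases hx.eq_or_lt with rfl | hx
    · simp; positivity
    have hy' : 0 < y := lt_of_le_of_ne hy fun h => hx.ne' (hxy h.symm)
    have h1 := Real.log_le_sub_one_of_pos (show 0 < r * y / x by positivity)
    rw [Real.log_div (by positivity) hx.ne', Real.log_mul hr.ne' hy'.ne'] at h1
    rw [Real.log_div hx.ne' hy'.ne']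
    have h2 := mul_le_mul_of_nonneg_left h1 hx.le
    have h3 : x * (r * y / x - 1) = r * y - x := by field_simp
    nlinarith
  rcases (add_nonneg ha hb).eq_or_lt with h | h
  · have ha0 : a = 0 := by linarith
    have hb0 : b = 0 := by linarith
    simp [ha0, hb0]
  have hcd : 0 < c + d := by
    refine lt_of_le_of_ne (add_nonneg hc hd) fun h' => h.ne ?_
    rw [hca (by linarith), hdb (by linarith), add_zero]
  have h1 := key a c ((a + b) / (c + d)) ha hc (by positivity) hca
  have h2 := key b d ((a + b) / (c + d)) hb hd (by positivity) hdb
  have h3 : (a + b) / (c + d) * c + (a + b) / (c + d) * d = a + b := by field_simp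
  linarith

/-- The mixture `(1 - s) μ + s ν`. -/
noncomputable def mix (s : ℝ) (μ ν : Measure ℝ) : Measure ℝ :=
  ENNReal.ofReal (1 - s) • μ + ENNReal.ofReal s • ν

section Mix

variable {s : ℝ} {μ ν : Measure ℝ}

lemma isProbabilityMeasure_mix [IsProbabilityMeasure μ] [IsProbabilityMeasure ν] (h0 : 0 ≤ s)
    (h1 : s ≤ 1) : IsProbabilityMeasure (mix s μ ν) := by
  refine ⟨?_⟩
  simp only [mix, Measure.add_apply, Measure.smul_apply, measure_univ, smul_eq_mul, mul_one]
  rw [← ENNReal.ofReal_add (by linarith) h0]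
  simp

lemma mix_compl {S : Set ℝ} (hμ : μ Sᶜ = 0) (hν : ν Sᶜ = 0) :
    mix s μ ν Sᶜ = 0 := by
  simp [mix, hμ, hν]

lemma mix_real [IsFiniteMeasure μ] [IsFiniteMeasure ν] (h0 : 0 ≤ s)
    (h1 : s ≤ 1) (B : Set ℝ) : (mix s μ ν).real B = (1 - s) * μ.real B + s * ν.real B := by
  simp only [mix, Measure.real, Measure.add_apply, Measure.smul_apply, smul_eq_mul]
  rw [ENNReal.toReal_add (ENNReal.mul_ne_top (by simp) (by finiteness))
    (ENNReal.mul_ne_top (by simp) (by finiteness)), ENNReal.toReal_mul, ENNReal.toReal_mul,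
    ENNReal.toReal_ofReal h0, ENNReal.toReal_ofReal (by linarith)]

lemma IsFinUnitDist.exists_finset₂ (hμ : IsFinUnitDist μ) (hν : IsFinUnitDist ν) :
    ∃ S : Finset ℝ, (∀ y ∈ S, y ∈ Set.Icc (0 : ℝ) 1) ∧ μ (S : Set ℝ)ᶜ = 0 ∧
      ν (S : Set ℝ)ᶜ = 0 := by
  classical
  obtain ⟨S, hS, hμS⟩ := hμ.exists_finset
  obtain ⟨S', hS', hνS⟩ := hν.exists_finset
  refine ⟨S ∪ S', fun y hy => ?_, measure_mono_null ?_ hμS, measure_mono_null ?_ hνS⟩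
  · rcases Finset.mem_union.1 hy with h | h
    exacts [hS y h, hS' y h]
  · exact Set.compl_subset_compl.2 (by simp)
  · exact Set.compl_subset_compl.2 (by simp)

lemma IsFinUnitDist.mix (hμ : IsFinUnitDist μ) (hν : IsFinUnitDist ν) (h0 : 0 ≤ s) (h1 : s ≤ 1) :
    IsFinUnitDist (mix s μ ν) := by
  obtain ⟨S, hS, hμS, hνS⟩ := hμ.exists_finset₂ hν
  have := hμ.isProb
  have := hν.isProb
  have := isProbabilityMeasure_mix (μ := μ) (ν := ν) h0 h1
  exact isFinUnitDist_of_finset hS (mix_compl hμS hνS)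

lemma IsFinUnitDist.mean_mix (hμ : IsFinUnitDist μ) (hν : IsFinUnitDist ν) (h0 : 0 ≤ s)
    (h1 : s ≤ 1) : mean (KinfBandit.mix s μ ν) = (1 - s) * mean μ + s * mean ν := by
  obtain ⟨S, hS, hμS, hνS⟩ := hμ.exists_finset₂ hν
  have := hμ.isProb
  have := hν.isProb
  have := isProbabilityMeasure_mix (μ := μ) (ν := ν) h0 h1
  rw [mean, mean, mean, integral_eq_sum hμS, integral_eq_sum hνS,
    integral_eq_sum (mix_compl hμS hνS), Finset.mul_sum, Finset.mul_sum, ← Finset.sum_add_distrib]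
  refine Finset.sum_congr rfl fun y _ => ?_
  rw [mix_real h0 h1]
  ring

lemma isFinUnitDist_dirac_one : IsFinUnitDist (Measure.dirac (1 : ℝ)) :=
  isFinUnitDist_of_finset (S := {1}) (by simp) (by simp)

lemma mean_dirac_one : mean (Measure.dirac (1 : ℝ)) = 1 := by simp [mean]

lemma IsUnitDist.mean_mem (hμ : IsUnitDist μ) : mean μ ∈ Set.Icc (0 : ℝ) 1 := by
  have := hμ.isProb
  have h : ∀ᵐ x ∂μ, x ∈ Set.Icc (0 : ℝ) 1 := mem_ae_iff.2 hμ.compl_eq_zero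
  have hint : Integrable (fun x : ℝ => x) μ :=
    Integrable.of_mem_Icc 0 1 measurable_id.aemeasurable h
  constructor
  · exact integral_nonneg_of_ae (h.mono fun x hx => hx.1)
  · have := integral_mono_ae hint (integrable_const 1) (h.mono fun x hx => hx.2)
    simpa [mean] using this

end Mix

/-- Joint convexity of the divergence, for distributions with finite support on the left. -/
lemma toReal_klDiv_mix_le {μ₁ μ₂ ν₁ ν₂ : Measure ℝ} (hμ₁ : IsFinUnitDist μ₁)
    (hμ₂ : IsFinUnitDist μ₂) [IsProbabilityMeasure ν₁] [IsProbabilityMeasure ν₂]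
    {s : ℝ} (h0 : 0 < s) (h1 : s < 1) (hk₁ : klDiv μ₁ ν₁ ≠ ∞) (hk₂ : klDiv μ₂ ν₂ ≠ ∞) :
    klDiv (mix s μ₁ μ₂) (mix s ν₁ ν₂) ≠ ∞ ∧
      (klDiv (mix s μ₁ μ₂) (mix s ν₁ ν₂)).toReal ≤
        (1 - s) * (klDiv μ₁ ν₁).toReal + s * (klDiv μ₂ ν₂).toReal := by
  obtain ⟨S, hS, h₁S, h₂S⟩ := hμ₁.exists_finset₂ hμ₂
  have := hμ₁.isProb
  have := hμ₂.isProb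
  have := isProbabilityMeasure_mix (μ := μ₁) (ν := μ₂) h0.le h1.le
  have := isProbabilityMeasure_mix (μ := ν₁) (ν := ν₂) h0.le h1.le
  have hs : 0 < 1 - s := by linarith
  have hz₁ := real_eq_zero_of_klDiv_ne_top hk₁
  have hz₂ := real_eq_zero_of_klDiv_ne_top hk₂
  obtain ⟨hfin, heq⟩ := klDiv_eq_sum (ν := mix s ν₁ ν₂) (mix_compl (s := s) h₁S h₂S) (by
    intro y _ hy
    rw [mix_real h0.le h1.le] at hy ⊢
    have ha : 0 ≤ (1 - s) * ν₁.real {y} := by positivity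
    have hb : 0 ≤ s * ν₂.real {y} := by positivity
    have ha0 : (1 - s) * ν₁.real {y} = 0 := by linarith
    have hb0 : s * ν₂.real {y} = 0 := by linarith
    rw [hz₁ y ((mul_eq_zero.1 ha0).resolve_left hs.ne'),
      hz₂ y ((mul_eq_zero.1 hb0).resolve_left h0.ne')]
    simp)
  refine ⟨hfin, ?_⟩
  rw [heq, (klDiv_eq_sum h₁S fun y _ => hz₁ y).2, (klDiv_eq_sum h₂S fun y _ => hz₂ y).2,
    Finset.mul_sum, Finset.mul_sum, ← Finset.sum_add_distrib]
  refine Finset.sum_le_sum fun y _ => ?_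
  rw [mix_real h0.le h1.le, mix_real h0.le h1.le]
  refine (log_sum_le (by positivity) (by positivity) (by positivity) (by positivity)
    (fun h => ?_) (fun h => ?_)).trans (le_of_eq ?_)
  · rw [hz₁ y ((mul_eq_zero.1 h).resolve_left hs.ne'), mul_zero]
  · rw [hz₂ y ((mul_eq_zero.1 h).resolve_left h0.ne'), mul_zero]
  · rw [mul_div_mul_left _ _ hs.ne', mul_div_mul_left _ _ h0.ne']
    ring

/-- Moving a fraction `s` of the mass of the second argument elsewhere costs at most
`-log (1 - s)`. -/
lemma toReal_klDiv_mix_right_le {μ ν ρ : Measure ℝ} (hμ : IsFinUnitDist μ)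
    [IsProbabilityMeasure ν] [IsProbabilityMeasure ρ] {s : ℝ} (h0 : 0 ≤ s) (h1 : s < 1)
    (hk : klDiv μ ν ≠ ∞) :
    klDiv μ (mix s ν ρ) ≠ ∞ ∧
      (klDiv μ (mix s ν ρ)).toReal ≤ (klDiv μ ν).toReal - Real.log (1 - s) := by
  obtain ⟨S, hS, hμS⟩ := hμ.exists_finset
  have := hμ.isProb
  have := isProbabilityMeasure_mix (μ := ν) (ν := ρ) h0 h1.le
  have hs : 0 < 1 - s := by linarith
  have hz := real_eq_zero_of_klDiv_ne_top hk
  obtain ⟨hfin, heq⟩ := klDiv_eq_sum (ν := mix s ν ρ) hμS (by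
    intro y _ hy
    rw [mix_real h0 h1.le] at hy
    have ha : 0 ≤ (1 - s) * ν.real {y} := by positivity
    have hb : 0 ≤ s * ρ.real {y} := by positivity
    have ha0 : (1 - s) * ν.real {y} = 0 := by linarith
    exact hz y ((mul_eq_zero.1 ha0).resolve_left hs.ne'))
  refine ⟨hfin, ?_⟩
  have hsum : Real.log (1 - s) = ∑ y ∈ S, μ.real {y} * Real.log (1 - s) := by
    rw [← Finset.sum_mul, sum_real_singleton hμS, one_mul]
  rw [heq, (klDiv_eq_sum hμS fun y _ => hz y).2, hsum, ← Finset.sum_sub_distrib]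
  refine Finset.sum_le_sum fun y _ => ?_
  rcases (measureReal_nonneg (μ := μ) (s := {y})).eq_or_lt with hp | hp
  · simp [← hp]
  have hν : 0 < ν.real {y} := lt_of_le_of_ne measureReal_nonneg fun h => hp.ne' (hz y h.symm)
  rw [← mul_sub]
  refine mul_le_mul_of_nonneg_left ?_ hp.le
  rw [← Real.log_div (by positivity) hs.ne', div_div]
  refine Real.log_le_log ?_ ?_
  · refine div_pos hp ?_
    rw [mix_real h0 h1.le]
    have hb : 0 ≤ s * ρ.real {y} := by positivity
    have : 0 < (1 - s) * ν.real {y} := by positivity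
    linarith
  · refine div_le_div_of_nonneg_left hp.le (by positivity) ?_
    rw [mix_real h0 h1.le]
    have hb : 0 ≤ s * ρ.real {y} := by positivity
    linarith

/-- Pinsker's inequality for a `[0,1]`-valued test function: the divergence dominates
`2 (∫ f dμ - ∫ f dν)²`, by the Donsker-Varadhan bound and Hoeffding's lemma. -/
lemma pinsker {μ ν : Measure ℝ} [IsProbabilityMeasure μ] [IsProbabilityMeasure ν]
    (hk : klDiv μ ν ≠ ∞) {f : ℝ → ℝ} (hf : Measurable f) (hfν : ∀ᵐ x ∂ν, f x ∈ Set.Icc (0 : ℝ) 1) :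
    2 * (∫ x, f x ∂μ - ∫ x, f x ∂ν) ^ 2 ≤ (klDiv μ ν).toReal := by
  obtain ⟨hac, hint⟩ := klDiv_ne_top_iff.1 hk
  have hfμ : ∀ᵐ x ∂μ, f x ∈ Set.Icc (0 : ℝ) 1 := hac.ae_le hfν
  set d : ℝ := ∫ x, f x ∂μ - ∫ x, f x ∂ν with hd
  have hfi : Integrable f μ := Integrable.of_mem_Icc 0 1 hf.aemeasurable hfμ
  -- the exponential tilt by `4 d (f - ∫ f dν)` is optimal in the sub-Gaussian bound
  set g : ℝ → ℝ := fun x => 4 * d * (f x - ∫ x, f x ∂ν) with hg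
  have hsub := hasSubgaussianMGF_of_mem_Icc (μ := ν) hf.aemeasurable hfν
  have hgν : Integrable (fun x => Real.exp (g x)) ν := hsub.integrable_exp_mul (4 * d)
  have hgμ : Integrable g μ := (hfi.sub (integrable_const _)).const_mul _
  have hmgf : ∫ x, Real.exp (g x) ∂ν ≤ Real.exp (2 * d ^ 2) := by
    have := hsub.mgf_le (4 * d)
    simp only [mgf] at this
    refine this.trans (Real.exp_le_exp.2 (le_of_eq ?_))
    norm_num
    ring
  have hprob : IsProbabilityMeasure (ν.tilted g) := isProbabilityMeasure_tilted hgν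
  have hac' : μ ≪ ν.tilted g := hac.trans (absolutelyContinuous_tilted hgν)
  have h1 := integral_llr_add_sub_measure_univ_nonneg hac'
    (integrable_llr_tilted_right hac hgμ hint hgν)
  rw [integral_llr_tilted_right hac hgμ hgν hint] at h1
  have h2 : ∫ x, g x ∂μ = 4 * d * d := by
    rw [hg, integral_const_mul, integral_sub hfi (integrable_const _)]
    simp [hd]
  have h3 : Real.log (∫ x, Real.exp (g x) ∂ν) ≤ 2 * d ^ 2 := by
    rw [Real.log_le_iff_le_exp (integral_exp_pos hgν)]
    exact hmgf
  rw [toReal_klDiv_of_measure_eq hac (by simp)]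
  simp only [probReal_univ] at h1
  rw [h2] at h1
  nlinarith

/-! ### Regularity of `kInf` and positivity of `theta` -/

section KInf

variable {ν ν₁ ν₂ ρ : Measure ℝ} {q q' γ s : ℝ}

lemma kInf_le (hρ : IsFinUnitDist ρ) (h : q < mean ρ) : kInf ν q ≤ klDiv ν ρ :=
  sInf_le ⟨ρ, hρ, h, rfl⟩

lemma exists_klDiv_lt_of_kInf_lt {r : ℝ≥0∞} (h : kInf ν q < r) :
    ∃ ρ, IsFinUnitDist ρ ∧ q < mean ρ ∧ klDiv ν ρ < r := by
  obtain ⟨_, ⟨ρ, hρ, hm, rfl⟩, hlt⟩ := sInf_lt_iff.1 h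
  exact ⟨ρ, hρ, hm, hlt⟩

lemma kInf_mono (h : q ≤ q') : kInf ν q ≤ kInf ν q' := by
  refine sInf_le_sInf ?_
  rintro _ ⟨ρ, hρ, hm, rfl⟩
  exact ⟨ρ, hρ, h.trans_lt hm, rfl⟩

/-- Moving the mass `(q' - q) / (1 - q)` of a competitor to the point `1` raises the constraint
on its expectation from `q` to `q'`. -/
lemma kInf_le_add (hν : IsFinUnitDist ν) (hqq : q ≤ q') (hq' : q' < 1) :
    kInf ν q' ≤ kInf ν q + ENNReal.ofReal ((q' - q) / (1 - q')) := by
  rw [kInf, kInf, ENNReal.sInf_add]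
  refine le_iInf₂ ?_
  rintro _ ⟨ρ, hρ, hm, rfl⟩
  by_cases hk : klDiv ν ρ = ∞
  · simp [hk]
  have := hν.isProb
  have := hρ.isProb
  have hq1 : 0 < 1 - q := by linarith
  have hq1' : 0 < 1 - q' := by linarith
  set s := (q' - q) / (1 - q) with hs
  have hs0 : 0 ≤ s := div_nonneg (by linarith) hq1.le
  have h1s : 1 - s = (1 - q') / (1 - q) := by rw [hs]; field_simp; ring
  have h1s0 : 0 < 1 - s := by rw [h1s]; positivity
  have hs1 : s < 1 := by linarith
  obtain ⟨hfin, hle⟩ := toReal_klDiv_mix_right_le (ρ := Measure.dirac (1 : ℝ)) hν hs0 hs1 hk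
  have hlog : -Real.log (1 - s) ≤ (q' - q) / (1 - q') := by
    rw [← Real.log_inv, h1s, inv_div]
    refine (Real.log_le_sub_one_of_pos (by positivity)).trans (le_of_eq ?_)
    field_simp
    ring
  refine (kInf_le (hρ.mix isFinUnitDist_dirac_one hs0 hs1.le) ?_).trans ?_
  · rw [hρ.mean_mix isFinUnitDist_dirac_one hs0 hs1.le, mean_dirac_one]
    have h2 : (1 - s) * q + s * 1 = q' := by rw [hs]; field_simp; ring
    nlinarith
  · rw [← ENNReal.ofReal_toReal hfin, ← ENNReal.ofReal_toReal hk,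
      ← ENNReal.ofReal_add ENNReal.toReal_nonneg (div_nonneg (by linarith) hq1'.le)]
    exact ENNReal.ofReal_le_ofReal (by linarith)

lemma kInf_eq_zero_of_lt_mean (hν : IsFinUnitDist ν) (h : q < mean ν) : kInf ν q = 0 := by
  have := hν.isProb
  simpa using kInf_le (ν := ν) hν h

/-- The mixtures of `ν` with the Dirac mass at `1` show that `kInf ν q` is at most
`log (1 / (1 - q))`. -/
lemma kInf_le_neg_log (hν : IsFinUnitDist ν) (hq0 : 0 ≤ q) (hq1 : q < 1) :
    kInf ν q ≠ ∞ ∧ (kInf ν q).toReal ≤ -Real.log (1 - q) := by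
  have := hν.isProb
  have key : ∀ s, q < s → s < 1 → kInf ν q ≠ ∞ ∧ (kInf ν q).toReal ≤ -Real.log (1 - s) := by
    intro s hqs hs1
    have hs0 : 0 ≤ s := by linarith
    obtain ⟨hfin, hle⟩ := toReal_klDiv_mix_right_le (ν := ν) (ρ := Measure.dirac (1 : ℝ)) hν hs0
      hs1 (by simp)
    have h := kInf_le (ν := ν) (q := q) (hν.mix isFinUnitDist_dirac_one hs0 hs1.le) (by
      rw [hν.mean_mix isFinUnitDist_dirac_one hs0 hs1.le, mean_dirac_one]
      have := hν.mean_mem.1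
      nlinarith)
    refine ⟨ne_top_of_le_ne_top hfin h, (ENNReal.toReal_mono hfin h).trans ?_⟩
    simpa using hle
  refine ⟨(key ((q + 1) / 2) (by linarith) (by linarith)).1, ?_⟩
  have hcont : ContinuousAt (fun s : ℝ => -Real.log (1 - s)) q :=
    ((continuousAt_const.sub continuousAt_id).log (by simp; linarith)).neg
  refine ge_of_tendsto (x := nhdsWithin q (Set.Ioi q))
     (hcont.tendsto.mono_left nhdsWithin_le_nhds) ?_
  filter_upwards [Ioo_mem_nhdsGT hq1] with s hs
  exact (key s hs.1 hs.2).2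

lemma mix_self [IsFiniteMeasure ν] (h0 : 0 ≤ s) (h1 : s ≤ 1) : mix s ν ν = ν := by
  rw [mix, ← add_smul, ← ENNReal.ofReal_add (by linarith) h0]
  simp

lemma kInf_mix_lt (hν₁ : IsFinUnitDist ν₁) (hν₂ : IsFinUnitDist ν₂) (h0 : 0 < s) (h1 : s < 1)
    (hk₁ : kInf ν₁ q < ENNReal.ofReal γ) (hk₂ : kInf ν₂ q < ENNReal.ofReal γ) :
    kInf (mix s ν₁ ν₂) q < ENNReal.ofReal γ := by
  obtain ⟨ρ₁, hρ₁, hm₁, hlt₁⟩ := exists_klDiv_lt_of_kInf_lt hk₁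
  obtain ⟨ρ₂, hρ₂, hm₂, hlt₂⟩ := exists_klDiv_lt_of_kInf_lt hk₂
  have := hρ₁.isProb
  have := hρ₂.isProb
  obtain ⟨hfin, hle⟩ := toReal_klDiv_mix_le hν₁ hν₂ h0 h1 hlt₁.ne_top hlt₂.ne_top
  refine (kInf_le (hρ₁.mix hρ₂ h0.le h1.le) ?_).trans_lt ?_
  · rw [hρ₁.mean_mix hρ₂ h0.le h1.le]
    nlinarith
  · rw [ENNReal.lt_ofReal_iff_toReal_lt hlt₁.ne_top] at hlt₁
    rw [ENNReal.lt_ofReal_iff_toReal_lt hlt₂.ne_top] at hlt₂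
    rw [ENNReal.lt_ofReal_iff_toReal_lt hfin]
    nlinarith

/-- If the expectation of `ν` is at most `q` while that of `ρ` is at least `q + ε`, then a
competitor for `kInf ν q` can be taken between `ρ` and `ν`, which gains `ε²` on `klDiv ν ρ`. -/
lemma kInf_add_sq_le_klDiv {ε : ℝ} (hν : IsFinUnitDist ν) (hρ : IsFinUnitDist ρ) (hε : 0 < ε)
    (hνq : mean ν ≤ q) (hρq : q + ε ≤ mean ρ) (hk : klDiv ν ρ ≠ ∞) :
    (kInf ν q).toReal + ε ^ 2 ≤ (klDiv ν ρ).toReal := by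
  have := hν.isProb
  have := hρ.isProb
  set d := mean ρ - mean ν with hd
  have hεd : ε ≤ d := by linarith
  have hd0 : 0 < d := by linarith
  have hpin : 2 * d ^ 2 ≤ (klDiv ν ρ).toReal := by
    have h := pinsker hk measurable_id (mem_ae_iff.2 hρ.compl_eq_zero)
    have h2 : (∫ x, id x ∂ν - ∫ x, id x ∂ρ) ^ 2 = d ^ 2 := by
      rw [hd, mean, mean]
      simp only [id]
      ring
    rwa [h2] at h
  -- half of the largest fraction of `ν` that keeps the expectation of the mixture above `q`
  set s := ε / (2 * d) with hs
  have hs0 : 0 < s := by positivity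
  have hsd : s * d = ε / 2 := by rw [hs]; field_simp
  have hs1 : s < 1 := by rw [hs, div_lt_one (by positivity)]; linarith
  obtain ⟨hfin, hle⟩ := toReal_klDiv_mix_le (ν₁ := ρ) (ν₂ := ν) hν hν hs0 hs1 hk (by simp)
  rw [mix_self hs0.le hs1.le] at hfin hle
  have h1 := ENNReal.toReal_mono hfin (kInf_le (ν := ν) (q := q) (hρ.mix hν hs0.le hs1.le) (by
    rw [hρ.mean_mix hν hs0.le hs1.le]
    have : (1 - s) * mean ρ + s * mean ν = mean ρ - s * d := by rw [hd]; ring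
    rw [this, hsd]
    linarith))
  have h3 := mul_le_mul_of_nonneg_left hpin hs0.le
  have h4 : s * (2 * d ^ 2) = ε * d := by
    have : s * (2 * d ^ 2) = 2 * d * (s * d) := by ring
    rw [this, hsd]; ring
  simp only [klDiv_self, ENNReal.toReal_zero, mul_zero, add_zero] at hle
  nlinarith

end KInf

/-- A distribution `ν'` whose divergence to `νa` is small satisfies `(1 - s) ν' ≤ νa`. Then `νa`
is a mixture of `ν'` and of some `ω`, and so is, with the same `ω`, a competitor for
`kInf νa ((1 - s) μs)` built on a competitor for `kInf ν' μs`. -/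
lemma theta_pos {νa : Measure ℝ} (hνa : IsFinUnitDist νa) {μs γ : ℝ} (hμs0 : 0 < μs)
    (hμs1 : μs < 1) (hγ : γ < (kInf νa μs).toReal) : 0 < theta νa μs γ := by
  have := hνa.isProb
  obtain ⟨S, hS, hνS⟩ := hνa.exists_finset
  set K := (kInf νa μs).toReal with hK
  obtain ⟨m, hm0, hm⟩ : ∃ m : ℝ, 0 < m ∧ ∀ y ∈ S, νa.real {y} ≠ 0 → m ≤ νa.real {y} := by
    classical
    rcases (S.filter fun y => νa.real {y} ≠ 0).eq_empty_or_nonempty with h | h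
    · refine ⟨1, one_pos, fun y hy hy0 => ?_⟩
      have : y ∈ S.filter fun y => νa.real {y} ≠ 0 := Finset.mem_filter.2 ⟨hy, hy0⟩
      simp [h] at this
    · obtain ⟨y₀, hy₀, hmin⟩ := Finset.exists_min_image _ (fun y => νa.real {y}) h
      exact ⟨νa.real {y₀}, lt_of_le_of_ne measureReal_nonneg (Finset.mem_filter.1 hy₀).2.symm,
        fun y hy hy0 => hmin y (Finset.mem_filter.2 ⟨hy, hy0⟩)⟩
  -- `s` is so small that the loss `s μs / (1 - μs)` in the constraint is at most `K - γ`
  set s := min (1 / 2) ((K - γ) * (1 - μs)) with hs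
  have hs0 : 0 < s := lt_min (by norm_num) (mul_pos (by linarith) (by linarith))
  have hs1 : s < 1 := (min_le_left _ _).trans_lt (by norm_num)
  have hsK : s * μs / (1 - μs) ≤ K - γ := by
    rw [div_le_iff₀ (by linarith)]
    have := min_le_right (1 / 2) ((K - γ) * (1 - μs))
    nlinarith
  refine lt_of_lt_of_le (b := ENNReal.ofReal (2 * (s * m) ^ 2)) (by simp; positivity) ?_
  refine le_sInf ?_
  rintro _ ⟨ν', hν', hlt, rfl⟩
  have := hν'.isProb
  by_contra! hsmall
  have hac : ν' ≪ νa := (klDiv_ne_top_iff.1 hsmall.ne_top).1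
  have hν'S : ν' (S : Set ℝ)ᶜ = 0 := hac hνS
  have hp : ∀ y ∈ S, (1 - s) * ν'.real {y} ≤ νa.real {y} := by
    intro y hy
    by_cases h0 : νa.real {y} = 0
    · rw [real_eq_zero_of_klDiv_ne_top hsmall.ne_top y h0, h0, mul_zero]
    have h1 := pinsker hsmall.ne_top (f := Set.indicator {y} 1)
      (measurable_one.indicator (measurableSet_singleton y))
      (Filter.Eventually.of_forall fun x => by by_cases hx : x = y <;> simp [Set.indicator, hx])
    rw [integral_indicator_one (measurableSet_singleton y),
      integral_indicator_one (measurableSet_singleton y)] at h1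
    rw [ENNReal.lt_ofReal_iff_toReal_lt hsmall.ne_top] at hsmall
    have h2 : ν'.real {y} - νa.real {y} < s * m := by
      refine lt_of_pow_lt_pow_left₀ 2 (by positivity) ?_
      linarith
    have h3 := mul_le_mul_of_nonneg_left (hm y hy h0) hs0.le
    have h4 : 0 ≤ νa.real {y} := measureReal_nonneg
    have h5 : ν'.real {y} ≤ (1 + s) * νa.real {y} := by linarith
    have h6 := mul_le_mul_of_nonneg_left h5 (show 0 ≤ 1 - s by linarith)
    nlinarith [mul_nonneg (sq_nonneg s) h4]
  set w : ℝ → ℝ := fun y => (νa.real {y} - (1 - s) * ν'.real {y}) / s with hw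
  have hw0 : ∀ y ∈ S, 0 ≤ w y := fun y hy => div_nonneg (by linarith [hp y hy]) hs0.le
  have hw1 : ∑ y ∈ S, w y = 1 := by
    rw [hw, ← Finset.sum_div, Finset.sum_sub_distrib, ← Finset.mul_sum, sum_real_singleton hνS,
      sum_real_singleton hν'S]
    field_simp
    ring
  have hωp := isProbabilityMeasure_discrete hw0 hw1
  have hω : IsFinUnitDist (discrete S w) := isFinUnitDist_of_finset hS (discrete_compl S w)
  have hmix : νa = mix s ν' (discrete S w) := by
    refine ext_of_finset hνS (mix_compl hν'S (discrete_compl S w)) fun y hy => ?_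
    have := isProbabilityMeasure_mix (μ := ν') (ν := discrete S w) hs0.le hs1.le
    rw [← ENNReal.toReal_eq_toReal_iff' (measure_ne_top _ _) (measure_ne_top _ _)]
    change νa.real {y} = (mix s ν' (discrete S w)).real {y}
    rw [mix_real hs0.le hs1.le, discrete_real_singleton hy (hw0 y hy), hw]
    field_simp
    ring
  obtain ⟨ρ, hρ, hρm, hρk⟩ := exists_klDiv_lt_of_kInf_lt hlt
  have := hρ.isProb
  obtain ⟨hfin, hle⟩ := toReal_klDiv_mix_le (ν₁ := ρ) (ν₂ := discrete S w) hν' hω hs0 hs1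
    hρk.ne_top (by simp)
  rw [← hmix] at hfin hle
  have h1 : (kInf νa ((1 - s) * μs)).toReal ≤ (klDiv νa (mix s ρ (discrete S w))).toReal :=
    ENNReal.toReal_mono hfin (kInf_le (hρ.mix hω hs0.le hs1.le) (by
      rw [hρ.mean_mix hω hs0.le hs1.le]
      have := hω.mean_mem.1
      nlinarith))
  have hq0 : 0 ≤ (1 - s) * μs := mul_nonneg (by linarith) hμs0.le
  have hqμ : (1 - s) * μs ≤ μs := by nlinarith
  have h2 := kInf_le_add hνa hqμ hμs1
  have hnt := (kInf_le_neg_log hνa hq0 (hqμ.trans_lt hμs1)).1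
  have h3 := ENNReal.toReal_mono (by finiteness) h2
  have h4 : (μs - (1 - s) * μs) / (1 - μs) = s * μs / (1 - μs) := by ring
  rw [ENNReal.toReal_add hnt ENNReal.ofReal_ne_top, h4,
    ENNReal.toReal_ofReal (div_nonneg (by positivity) (by linarith)), ← hK] at h3
  rw [ENNReal.lt_ofReal_iff_toReal_lt hρk.ne_top] at hρk
  simp only [klDiv_self, ENNReal.toReal_zero, mul_zero, add_zero] at hle
  have h5 : (1 - s) * (klDiv ν' ρ).toReal ≤ (klDiv ν' ρ).toReal := by
    have : 0 ≤ (klDiv ν' ρ).toReal := ENNReal.toReal_nonneg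
    nlinarith
  linarith

/-! ### Sanov-type bounds for types -/

section Types

variable {S : Finset ℝ} {k : ℕ}

/-- The empirical distribution of a sample of size `k` in which each `y ∈ S` occurs `n y` times. -/
noncomputable def typeDist (S : Finset ℝ) (k : ℕ) (n : ℝ → ℕ) : Measure ℝ :=
  discrete S fun y => (n y : ℝ) / k

lemma sum_div_eq_one (hk : k ≠ 0) {n : ℝ → ℕ} (hn : n ∈ S.piAntidiag k) :
    ∑ y ∈ S, (n y : ℝ) / k = 1 := by
  rw [← Finset.sum_div, ← Nat.cast_sum, (Finset.mem_piAntidiag.1 hn).1]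
  exact div_self (by exact_mod_cast hk)

lemma isFinUnitDist_typeDist (hS : ∀ y ∈ S, y ∈ Set.Icc (0 : ℝ) 1) (hk : k ≠ 0) {n : ℝ → ℕ}
    (hn : n ∈ S.piAntidiag k) : IsFinUnitDist (typeDist S k n) := by
  have : IsProbabilityMeasure (typeDist S k n) :=
    isProbabilityMeasure_discrete (fun y _ => by positivity) (sum_div_eq_one hk hn)
  exact isFinUnitDist_of_finset hS (discrete_compl _ _)

lemma card_piAntidiag_le (S : Finset ℝ) (k : ℕ) : (S.piAntidiag k).card ≤ (k + 1) ^ S.card := by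
  have h : (S.piAntidiag k).card ≤ (S.pi fun _ => Finset.range (k + 1)).card := by
    refine Finset.card_le_card_of_injOn (fun n y _ => n y) ?_ ?_
    · intro n hn
      obtain ⟨hsum, -⟩ := Finset.mem_piAntidiag.1 (Finset.mem_coe.1 hn)
      refine Finset.mem_coe.2 (Finset.mem_pi.2 fun y hy => Finset.mem_range_succ_iff.2 ?_)
      exact hsum ▸ Finset.single_le_sum (f := n) (fun _ _ => Nat.zero_le _) hy
    · intro n hn n' hn' h
      obtain ⟨-, h0⟩ := Finset.mem_piAntidiag.1 (Finset.mem_coe.1 hn)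
      obtain ⟨-, h0'⟩ := Finset.mem_piAntidiag.1 (Finset.mem_coe.1 hn')
      funext y
      by_cases hy : y ∈ S
      · exact congrFun (congrFun h y) hy
      · rw [not_imp_comm.1 (h0 y) hy, not_imp_comm.1 (h0' y) hy]
  simpa using h

/-- A family `π` of masses on the types of size `k` is dominated by likelihood ratios if it gives
total mass at most `1` to every product likelihood `∏ r(y)^{n(y)}`, where `r` is a nonnegative
function with `∑ p(y) r(y) = 1`. This holds for the probabilities of the types of the payoffs of
an arm with distribution `p`, also when the sample size is reached at a random time. -/
def LikelihoodDominated (S : Finset ℝ) (k : ℕ) (p : ℝ → ℝ) (π : (ℝ → ℕ) → ℝ) : Prop :=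
  ∀ r : ℝ → ℝ, (∀ y ∈ S, 0 ≤ r y) → ∑ y ∈ S, p y * r y = 1 →
    ∑ n ∈ S.piAntidiag k, π n * ∏ y ∈ S, r y ^ n y ≤ 1

variable {p : ℝ → ℝ} {π : (ℝ → ℕ) → ℝ}

/-- The bound common to large deviations of a single type and of a convex set of types: if the
distribution with weights `w` on `S` is the `π`-average of the types in `𝒞`, then the total mass
of `𝒞` is at most `exp (-k KL(w, p))`. -/
lemma LikelihoodDominated.sum_le (hdom : LikelihoodDominated S k p π) (hk : k ≠ 0)
    (hp : ∀ y ∈ S, 0 < p y) (hπ : ∀ n, 0 ≤ π n) {𝒞 : Finset (ℝ → ℕ)} (h𝒞 : 𝒞 ⊆ S.piAntidiag k)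
    {w : ℝ → ℝ} (hw1 : ∑ y ∈ S, w y = 1)
    (hw : ∀ y ∈ S, (∑ n ∈ 𝒞, π n) * w y = ∑ n ∈ 𝒞, π n * ((n y : ℝ) / k))
    (hpos : 0 < ∑ n ∈ 𝒞, π n) :
    ∑ n ∈ 𝒞, π n ≤ Real.exp (-(k * ∑ y ∈ S, w y * Real.log (w y / p y))) := by
  set M := ∑ n ∈ 𝒞, π n with hM
  have hk' : (0 : ℝ) < k := by exact_mod_cast Nat.pos_of_ne_zero hk
  have hw0 : ∀ y ∈ S, 0 ≤ w y := fun y hy => by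
    have h : 0 ≤ M * w y := by
      rw [hw y hy]
      exact Finset.sum_nonneg fun n _ => mul_nonneg (hπ n) (by positivity)
    exact nonneg_of_mul_nonneg_right h hpos
  set r : ℝ → ℝ := fun y => w y / p y with hr
  have hr0 : ∀ y ∈ S, 0 ≤ r y := fun y hy => div_nonneg (hw0 y hy) (hp y hy).le
  have h1 : ∑ n ∈ 𝒞, π n * ∏ y ∈ S, r y ^ n y ≤ 1 := by
    refine le_trans ?_ (hdom r hr0 ?_)
    · refine Finset.sum_le_sum_of_subset_of_nonneg h𝒞 fun n _ _ => mul_nonneg (hπ n) ?_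
      exact Finset.prod_nonneg fun y hy => pow_nonneg (hr0 y hy) _
    · rw [← hw1]
      refine Finset.sum_congr rfl fun y hy => ?_
      have := (hp y hy).ne'
      rw [hr]
      field_simp
  set c : ℝ := k * ∑ y ∈ S, w y * Real.log (w y / p y) with hc
  -- `x ≥ 1 + log x` applied to `x = e⁻ᶜ ∏ r(y)^{n(y)}`, and the logarithms average to `0`
  have h2 : ∀ n ∈ 𝒞, π n * (1 + (∑ y ∈ S, n y * Real.log (r y) - c)) ≤
      π n * (∏ y ∈ S, r y ^ n y) * Real.exp (-c) := by
    intro n hn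
    rcases (hπ n).eq_or_lt with h0 | h0
    · simp [← h0]
    have hrn : ∀ y ∈ S, n y ≠ 0 → 0 < r y := by
      intro y hy hny
      refine div_pos ?_ (hp y hy)
      have h : 0 < M * w y := by
        rw [hw y hy]
        have hle := Finset.single_le_sum (f := fun n : ℝ → ℕ => π n * ((n y : ℝ) / k))
          (fun n _ => mul_nonneg (hπ n) (by positivity)) hn
        refine lt_of_lt_of_le ?_ hle
        have : (0 : ℝ) < n y := by exact_mod_cast Nat.pos_of_ne_zero hny
        positivity
      exact pos_of_mul_pos_right h hpos.le
    have hprod : ∏ y ∈ S, r y ^ n y = Real.exp (∑ y ∈ S, n y * Real.log (r y)) := by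
      rw [Real.exp_sum]
      refine Finset.prod_congr rfl fun y hy => ?_
      by_cases hny : n y = 0
      · simp [hny]
      · rw [Real.exp_nat_mul, Real.exp_log (hrn y hy hny)]
    rw [hprod, mul_assoc, ← Real.exp_add]
    refine mul_le_mul_of_nonneg_left ?_ h0.le
    have := Real.add_one_le_exp (∑ y ∈ S, n y * Real.log (r y) + -c)
    linarith
  have h3 := Finset.sum_le_sum h2
  rw [← Finset.sum_mul] at h3
  have h4 : ∑ n ∈ 𝒞, π n * (1 + (∑ y ∈ S, n y * Real.log (r y) - c)) = M := by
    have h5 : ∑ n ∈ 𝒞, π n * ∑ y ∈ S, n y * Real.log (r y) = M * c := by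
      simp only [Finset.mul_sum]
      rw [Finset.sum_comm, hc, Finset.mul_sum, Finset.mul_sum]
      refine Finset.sum_congr rfl fun y hy => ?_
      have h6 := hw y hy
      calc ∑ n ∈ 𝒞, π n * (n y * Real.log (r y))
          = k * Real.log (r y) * ∑ n ∈ 𝒞, π n * ((n y : ℝ) / k) := by
            rw [Finset.mul_sum]
            exact Finset.sum_congr rfl fun n _ => by field_simp
        _ = M * (k * (w y * Real.log (w y / p y))) := by rw [← h6]; ring
    simp only [mul_add, mul_sub, mul_one, Finset.sum_add_distrib, Finset.sum_sub_distrib, h5,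
      ← Finset.sum_mul]
    rw [← hM]; ring
  rw [h4] at h3
  refine h3.trans ?_
  have := mul_le_mul_of_nonneg_right h1 (Real.exp_pos (-c)).le
  linarith

variable {ν : Measure ℝ} [IsProbabilityMeasure ν]

lemma klDiv_discrete_eq_sum (hp : ∀ y ∈ S, 0 < ν.real {y}) {w : ℝ → ℝ}
    (hw0 : ∀ y ∈ S, 0 ≤ w y) (hw1 : ∑ y ∈ S, w y = 1) :
    klDiv (discrete S w) ν ≠ ∞ ∧
      (klDiv (discrete S w) ν).toReal = ∑ y ∈ S, w y * Real.log (w y / ν.real {y}) := by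
  have := isProbabilityMeasure_discrete hw0 hw1
  obtain ⟨h1, h2⟩ := klDiv_eq_sum (ν := ν) (discrete_compl S w)
    fun y hy h => absurd h (hp y hy).ne'
  refine ⟨h1, h2.trans (Finset.sum_congr rfl fun y hy => ?_)⟩
  rw [discrete_real_singleton hy (hw0 y hy)]

/-- A single type `n` has mass at most `exp (-k KL(n / k, ν))`. -/
lemma LikelihoodDominated.le_exp_klDiv
    (hdom : LikelihoodDominated S k (fun y => ν.real {y}) π) (hk : k ≠ 0)
    (hp : ∀ y ∈ S, 0 < ν.real {y}) (hπ : ∀ n, 0 ≤ π n) {n : ℝ → ℕ} (hn : n ∈ S.piAntidiag k) :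
    klDiv (typeDist S k n) ν ≠ ∞ ∧
      π n ≤ Real.exp (-(k * (klDiv (typeDist S k n) ν).toReal)) := by
  have hw1 := sum_div_eq_one hk hn
  obtain ⟨h1, h2⟩ := klDiv_discrete_eq_sum hp (fun y _ => by positivity) hw1
  refine ⟨h1, ?_⟩
  rcases (hπ n).eq_or_lt with h | h
  · rw [← h]; positivity
  have := hdom.sum_le hk hp hπ (𝒞 := {n}) (by simpa using hn) hw1 (by simp) (by simpa using h)
  rw [typeDist, h2]
  simpa using this

/-- Sanov's upper bound, without polynomial factor, for the convex set of the distributions `ν'`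
with `kInf ν' q < γ`: the conditional average of the types lies in the convex set. -/
lemma LikelihoodDominated.sum_le_exp_theta
    (hdom : LikelihoodDominated S k (fun y => ν.real {y}) π) (hk : k ≠ 0)
    (hp : ∀ y ∈ S, 0 < ν.real {y}) (hπ : ∀ n, 0 ≤ π n) (hS : ∀ y ∈ S, y ∈ Set.Icc (0 : ℝ) 1)
    {q γ : ℝ} {𝒞 : Finset (ℝ → ℕ)} (h𝒞 : 𝒞 ⊆ S.piAntidiag k)
    (hlt : ∀ n ∈ 𝒞, kInf (typeDist S k n) q < ENNReal.ofReal γ) (hpos : 0 < ∑ n ∈ 𝒞, π n) :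
    theta ν q γ ≠ ∞ ∧ ∑ n ∈ 𝒞, π n ≤ Real.exp (-(k * (theta ν q γ).toReal)) := by
  set W : Set (ℝ → ℝ) := {w | (∀ y ∈ S, 0 ≤ w y) ∧ ∑ y ∈ S, w y = 1 ∧
    kInf (discrete S w) q < ENNReal.ofReal γ} with hW
  have hconv : Convex ℝ W := by
    rw [convex_iff_forall_pos]
    rintro w ⟨hw0, hw1, hwk⟩ v ⟨hv0, hv1, hvk⟩ s t hs ht hst
    have hsum0 : ∀ y ∈ S, 0 ≤ (s • w + t • v) y := fun y hy => by
      have := hw0 y hy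
      have := hv0 y hy
      simp only [Pi.add_apply, Pi.smul_apply, smul_eq_mul]
      positivity
    refine ⟨hsum0, ?_, ?_⟩
    · simp only [Pi.add_apply, Pi.smul_apply, smul_eq_mul]
      rw [Finset.sum_add_distrib, ← Finset.mul_sum, ← Finset.mul_sum, hw1, hv1]
      linarith
    · have := isProbabilityMeasure_discrete hw0 hw1
      have := isProbabilityMeasure_discrete hv0 hv1
      have h := kInf_mix_lt (isFinUnitDist_of_finset hS (discrete_compl S w))
        (isFinUnitDist_of_finset hS (discrete_compl S v)) ht (by linarith) hwk hvk
      have := isProbabilityMeasure_mix (μ := discrete S w) (ν := discrete S v) ht.le (by linarith)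
      convert h using 2
      refine ext_of_finset (discrete_compl _ _) (mix_compl (discrete_compl _ _)
        (discrete_compl _ _)) fun y hy => ?_
      rw [discrete_singleton _ hy, ← ENNReal.ofReal_toReal (measure_ne_top (mix _ _ _) {y})]
      congr 1
      change _ = (mix _ _ _).real {y}
      rw [mix_real ht.le (by linarith), discrete_real_singleton hy (hw0 y hy),
        discrete_real_singleton hy (hv0 y hy), ← hst]
      simp
  set M := ∑ n ∈ 𝒞, π n with hM
  set w : ℝ → ℝ := ∑ n ∈ 𝒞, (π n / M) • fun y => (n y : ℝ) / k with hw
  have hwW : w ∈ W := by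
    refine hconv.sum_mem (fun n _ => div_nonneg (hπ n) hpos.le) ?_ fun n hn => ?_
    · rw [← Finset.sum_div, div_self hpos.ne']
    · exact ⟨fun y _ => by positivity, sum_div_eq_one hk (h𝒞 hn), hlt n hn⟩
  obtain ⟨hw0, hw1, hwk⟩ := hwW
  have := isProbabilityMeasure_discrete hw0 hw1
  obtain ⟨hfin, heq⟩ := klDiv_discrete_eq_sum hp hw0 hw1
  have hθ : theta ν q γ ≤ klDiv (discrete S w) ν :=
    sInf_le ⟨_, isFinUnitDist_of_finset hS (discrete_compl S w), hwk, rfl⟩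
  refine ⟨ne_top_of_le_ne_top hfin hθ, (hdom.sum_le hk hp hπ h𝒞 hw1 (fun y _ => ?_) hpos).trans ?_⟩
  · rw [hw, Finset.sum_apply, Finset.mul_sum]
    refine Finset.sum_congr rfl fun n _ => ?_
    simp only [Pi.smul_apply, smul_eq_mul]
    field_simp
    rw [← hM]; ring
  · rw [← heq]
    have := ENNReal.toReal_mono hfin hθ
    gcongr

end Types

/-! ### Likelihood ratios in the bandit game -/

section Counting

variable {Ω : Type*} {𝒜 : Type*} [DecidableEq 𝒜] {A : ℕ → Ω → 𝒜} {Y : ℕ → Ω → ℝ} {b : 𝒜} {ω : Ω}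

lemma pulls_succ (t : ℕ) : pulls A b (t + 1) ω =
    if A (t + 1) ω = b then insert (t + 1) (pulls A b t ω) else pulls A b t ω := by
  simp only [pulls]
  rw [← Finset.insert_Icc_right_eq_Icc_add_one (by omega), Finset.filter_insert]

lemma succ_notMem_pulls (t : ℕ) : t + 1 ∉ pulls A b t ω := by
  simp [pulls]

lemma numPulls_zero : numPulls A b 0 ω = 0 := by simp [numPulls, pulls]

lemma numPulls_succ (t : ℕ) : numPulls A b (t + 1) ω =
    numPulls A b t ω + if A (t + 1) ω = b then 1 else 0 := by
  simp only [numPulls]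
  rw [pulls_succ]
  split_ifs
  · rw [Finset.card_insert_of_notMem (succ_notMem_pulls t)]
  · rfl

lemma pulls_mono {t t' : ℕ} (h : t ≤ t') : pulls A b t ω ⊆ pulls A b t' ω :=
  Finset.filter_subset_filter _ (Finset.Icc_subset_Icc_right h)

lemma numPulls_mono {t t' : ℕ} (h : t ≤ t') : numPulls A b t ω ≤ numPulls A b t' ω :=
  Finset.card_le_card (pulls_mono h)

lemma numPulls_le (t : ℕ) : numPulls A b t ω ≤ t :=
  (Finset.card_filter_le _ _).trans (by simp)

lemma pulls_eq_of_numPulls_eq {t t' : ℕ} (h : numPulls A b t ω = numPulls A b t' ω) :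
    pulls A b t ω = pulls A b t' ω := by
  rcases le_total t t' with h' | h'
  · exact Finset.eq_of_subset_of_card_le (pulls_mono h') h.ge
  · exact (Finset.eq_of_subset_of_card_le (pulls_mono h') h.le).symm

/-- The number of times the payoff `y` was obtained from arm `b` till round `t`. -/
noncomputable def payoffCount (A : ℕ → Ω → 𝒜) (Y : ℕ → Ω → ℝ) (b : 𝒜) (t : ℕ) (ω : Ω) (y : ℝ) : ℕ :=
  ((pulls A b t ω).filter fun s => Y s ω = y).card

/-- The event that, at some round `t ≤ T`, arm `b` has been pulled `k` times and the payoff of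
each `y ∈ S` has been obtained `n y` times from it. -/
def typeEvent (A : ℕ → Ω → 𝒜) (Y : ℕ → Ω → ℝ) (b : 𝒜) (S : Finset ℝ) (T k : ℕ) (n : ℝ → ℕ) :
    Set Ω :=
  {ω | ∃ t ≤ T, numPulls A b t ω = k ∧ ∀ y ∈ S, payoffCount A Y b t ω y = n y}

lemma eq_of_mem_typeEvent {S : Finset ℝ} {T T' k : ℕ} {n n' : ℝ → ℕ} (hn : n ∈ S.piAntidiag k)
    (hn' : n' ∈ S.piAntidiag k) (h : ω ∈ typeEvent A Y b S T k n)
    (h' : ω ∈ typeEvent A Y b S T' k n') : n = n' := by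
  obtain ⟨t, -, ht, hy⟩ := h
  obtain ⟨t', -, ht', hy'⟩ := h'
  have hp := pulls_eq_of_numPulls_eq (A := A) (b := b) (ω := ω) (ht.trans ht'.symm)
  funext y
  by_cases hyS : y ∈ S
  · rw [← hy y hyS, ← hy' y hyS, payoffCount, payoffCount, hp]
  · rw [not_imp_comm.1 ((Finset.mem_piAntidiag.1 hn).2 y) hyS,
      not_imp_comm.1 ((Finset.mem_piAntidiag.1 hn').2 y) hyS]

lemma payoffCount_mem_piAntidiag {S : Finset ℝ} {t : ℕ} (hY : ∀ s ∈ pulls A b t ω, Y s ω ∈ S) :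
    (fun y => if y ∈ S then payoffCount A Y b t ω y else 0) ∈
      S.piAntidiag (numPulls A b t ω) := by
  refine Finset.mem_piAntidiag.2 ⟨?_, fun y hy => by simpa using fun h => hy (if_neg h)⟩
  rw [numPulls, Finset.card_eq_sum_card_fiberwise hY]
  exact Finset.sum_congr rfl fun y hy => if_pos hy

lemma empDist_eq_typeDist {S : Finset ℝ} {t k : ℕ} {n : ℝ → ℕ} (hk : k ≠ 0)
    (ht : numPulls A b t ω = k) (hY : ∀ s ∈ pulls A b t ω, Y s ω ∈ S)
    (hn : ∀ y ∈ S, payoffCount A Y b t ω y = n y) :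
    empDist A Y b t ω = typeDist S k n := by
  refine ext_of_finset ?_ (discrete_compl _ _) fun y hy => ?_
  · simp only [empDist, Measure.smul_apply, Measure.finsetSum_apply, smul_eq_mul]
    rw [Finset.sum_eq_zero, mul_zero]
    intro s hs
    rw [Measure.dirac_apply' _ S.measurableSet.compl]
    simp [hY s hs]
  · rw [typeDist, discrete_singleton _ hy, ← hn y hy]
    simp only [empDist, Measure.smul_apply, Measure.finsetSum_apply, smul_eq_mul, ht]
    have : ∑ s ∈ pulls A b t ω, Measure.dirac (Y s ω) {y} = (payoffCount A Y b t ω y : ℝ≥0∞) := by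
      rw [payoffCount, Finset.card_filter, Nat.cast_sum]
      refine Finset.sum_congr rfl fun s _ => ?_
      rw [Measure.dirac_apply]
      by_cases h : Y s ω = y <;> simp [h]
    rw [this, ENNReal.ofReal_div_of_pos (by exact_mod_cast Nat.pos_of_ne_zero hk),
      ENNReal.ofReal_natCast, ENNReal.ofReal_natCast, ENNReal.div_eq_inv_mul]

/-- The likelihood ratio `∏ r(Y s)` over the first `k` pulls of arm `b`, stopped at round `t`. -/
noncomputable def stoppedLikelihood (A : ℕ → Ω → 𝒜) (Y : ℕ → Ω → ℝ) (b : 𝒜) (k : ℕ)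
    (r : ℝ → ℝ≥0∞) (t : ℕ) (ω : Ω) : ℝ≥0∞ :=
  ∏ s ∈ Finset.range t,
    if A (s + 1) ω = b ∧ numPulls A b s ω < k then r (Y (s + 1) ω) else 1

lemma stoppedLikelihood_eq_prod {k t : ℕ} (r : ℝ → ℝ≥0∞) (h : numPulls A b t ω ≤ k) :
    stoppedLikelihood A Y b k r t ω = ∏ s ∈ pulls A b t ω, r (Y s ω) := by
  induction t with
  | zero => simp [stoppedLikelihood, pulls]
  | succ t ih =>
    rw [numPulls_succ] at h
    have hih := ih (by omega)
    rw [stoppedLikelihood] at hih ⊢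
    rw [Finset.prod_range_succ, hih, pulls_succ]
    by_cases hA : A (t + 1) ω = b
    · rw [if_pos hA] at h
      rw [if_pos ⟨hA, by omega⟩, if_pos hA, Finset.prod_insert (succ_notMem_pulls t), mul_comm]
    · rw [if_neg (fun h => hA h.1), if_neg hA, mul_one]

lemma stoppedLikelihood_const {k t T : ℕ} (r : ℝ → ℝ≥0∞) (h : numPulls A b t ω = k) (hT : t ≤ T) :
    stoppedLikelihood A Y b k r T ω = stoppedLikelihood A Y b k r t ω := by
  induction T, hT using Nat.le_induction with
  | base => rfl
  | succ T hT ih =>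
    rw [← ih, stoppedLikelihood, Finset.prod_range_succ, if_neg, mul_one, ← stoppedLikelihood]
    rintro ⟨-, h'⟩
    have := numPulls_mono (A := A) (b := b) (ω := ω) hT
    omega

end Counting

section Game

variable {Ω : Type*} [mΩ : MeasurableSpace Ω] {P : Measure Ω} {𝒜 : Type*}
  {ν : 𝒜 → Measure ℝ} {ℱ : Filtration ℕ mΩ} {A : ℕ → Ω → 𝒜}
  {Y : ℕ → Ω → ℝ}

lemma IsBanditGame.measurable_numPulls [DecidableEq 𝒜]
    (hgame : IsBanditGame P ν ℱ A Y) (b : 𝒜) (t : ℕ) :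
    Measurable[ℱ t] (numPulls A b t) := by
  induction t with
  | zero =>
    have : numPulls A b 0 = fun _ => 0 := funext fun ω => numPulls_zero
    rw [this]
    exact measurable_const
  | succ t ih =>
    have : numPulls A b (t + 1) =
        fun ω => numPulls A b t ω + if A (t + 1) ω = b then 1 else 0 :=
      funext fun ω => numPulls_succ t
    rw [this]
    refine (ih.mono (ℱ.mono (by omega)) le_rfl).add ?_
    exact Measurable.ite (ℱ.mono (by omega) _ (hgame.measurable_choice t b)) measurable_const
      measurable_const

/-- The law of the payoff of round `t + 1`, jointly with the past. -/
lemma IsBanditGame.measure_inter [IsProbabilityMeasure P]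
    (hgame : IsBanditGame P ν ℱ A Y) (t : ℕ) (b : 𝒜)
    [IsProbabilityMeasure (ν b)] {F : Set Ω} (hF : MeasurableSet[ℱ t] F) {B : Set ℝ}
    (hB : MeasurableSet B) :
    P (F ∩ {ω | A (t + 1) ω = b} ∩ Y (t + 1) ⁻¹' B) =
      ν b B * P (F ∩ {ω | A (t + 1) ω = b}) := by
  have hYm : Measurable (Y (t + 1)) :=
    (hgame.measurable_payoff (t + 1) (by omega)).mono (ℱ.le _) le_rfl
  have hG : MeasurableSet[ℱ t] (F ∩ {ω | A (t + 1) ω = b}) :=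
    MeasurableSet.inter hF (hgame.measurable_choice t b)
  have hG' := ℱ.le t _ hG
  have h1 := setIntegral_condExp (μ := P) (ℱ.le t)
    (f := (Y (t + 1) ⁻¹' B).indicator (fun _ => (1 : ℝ)))
    ((integrable_const 1).indicator (hYm hB)) hG
  rw [setIntegral_congr_ae (g := fun _ => (ν b).real B) hG' ?_, setIntegral_const,
    integral_indicator_const _ (hYm hB)] at h1
  · simp only [smul_eq_mul, mul_one] at h1
    rw [measureReal_restrict_apply (hYm hB)] at h1
    rw [Set.inter_comm, ← ENNReal.toReal_eq_toReal_iff' (by finiteness) (by finiteness),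
      ENNReal.toReal_mul]
    simp only [Measure.real] at h1
    linarith
  · filter_upwards [hgame.cond_law t B hB] with ω hω hωG
    rw [hω, show A (t + 1) ω = b from hωG.2]

lemma IsBanditGame.ae_payoff_mem [IsProbabilityMeasure P] [DecidableEq 𝒜]
    (hgame : IsBanditGame P ν ℱ A Y) (b : 𝒜)
    [IsProbabilityMeasure (ν b)] {S : Finset ℝ} (hS : ν b (S : Set ℝ)ᶜ = 0) :
    ∀ᵐ ω ∂P, ∀ t, ∀ s ∈ pulls A b t ω, Y s ω ∈ S := by
  have h : ∀ᵐ ω ∂P, ∀ s : ℕ, A (s + 1) ω = b → Y (s + 1) ω ∈ S := by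
    rw [ae_all_iff]
    intro s
    have h1 := hgame.measure_inter s b MeasurableSet.univ S.measurableSet.compl
    rw [hS, zero_mul] at h1
    rw [ae_iff]
    convert h1 using 2
    ext ω
    simp
  filter_upwards [h] with ω hω t s hs
  obtain ⟨h1, h2⟩ := Finset.mem_filter.1 hs
  obtain ⟨s, rfl⟩ := Nat.exists_eq_add_of_le' (Finset.mem_Icc.1 h1).1
  exact hω s h2

/-- On the event that arm `b` is chosen, the next payoff is independent of the past and has
law `ν b`. -/
lemma IsBanditGame.setLIntegral_mul_payoff [IsProbabilityMeasure P]
    (hgame : IsBanditGame P ν ℱ A Y) (t : ℕ) (b : 𝒜)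
    [IsProbabilityMeasure (ν b)] {g : Ω → ℝ≥0∞} (hg : Measurable[ℱ t] g) {r : ℝ → ℝ≥0∞}
    (hr : Measurable r) :
    ∫⁻ ω in {ω | A (t + 1) ω = b}, g ω * r (Y (t + 1) ω) ∂P =
      (∫⁻ ω in {ω | A (t + 1) ω = b}, g ω ∂P) * ∫⁻ y, r y ∂(ν b) := by
  set D : Set Ω := {ω | A (t + 1) ω = b} with hD
  have hDm : MeasurableSet D := ℱ.le t _ (hgame.measurable_choice t b)
  have hYm : Measurable (Y (t + 1)) :=
    (hgame.measurable_payoff (t + 1) (by omega)).mono (ℱ.le _) le_rfl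
  have hg' : Measurable g := hg.mono (ℱ.le t) le_rfl
  have h1 : ∀ B : Set ℝ, MeasurableSet B →
      ∫⁻ ω in Y (t + 1) ⁻¹' B ∩ D, g ω ∂P = ν b B * ∫⁻ ω in D, g ω ∂P := by
    intro B hB
    have h2 : (P.restrict (Y (t + 1) ⁻¹' B ∩ D)).trim (ℱ.le t) =
        ν b B • (P.restrict D).trim (ℱ.le t) := by
      refine @Measure.ext _ (ℱ t) _ _ fun F hF => ?_
      have hF' := ℱ.le t _ hF
      rw [Measure.smul_apply, trim_measurableSet_eq _ hF, trim_measurableSet_eq _ hF,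
        Measure.restrict_apply hF', Measure.restrict_apply hF', smul_eq_mul,
        ← hgame.measure_inter t b hF hB]
      congr 1
      ext ω
      simp only [Set.mem_inter_iff, hD]
      tauto
    rw [← lintegral_trim (ℱ.le t) hg, h2, lintegral_smul_measure, lintegral_trim (ℱ.le t) hg,
      smul_eq_mul]
  have h2 : ((P.restrict D).withDensity g).map (Y (t + 1)) = (∫⁻ ω in D, g ω ∂P) • ν b := by
    ext B hB
    rw [Measure.map_apply hYm hB, withDensity_apply _ (hYm hB), Measure.restrict_restrict (hYm hB),
      h1 B hB, Measure.smul_apply, smul_eq_mul, mul_comm]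
  have h3 := congrArg (fun ρ => ∫⁻ y, r y ∂ρ) h2
  rwa [lintegral_map hr hYm, lintegral_withDensity_eq_lintegral_mul _ hg'
    (g := fun ω => r (Y (t + 1) ω)) (hr.comp hYm),
    lintegral_smul_measure, smul_eq_mul] at h3

lemma IsBanditGame.measurable_stoppedLikelihood [DecidableEq 𝒜]
    (hgame : IsBanditGame P ν ℱ A Y) (b : 𝒜) (k : ℕ)
    {r : ℝ → ℝ≥0∞} (hr : Measurable r) (t : ℕ) :
    Measurable[ℱ t] (stoppedLikelihood A Y b k r t) := by
  refine Finset.measurable_prod _ fun s hs => ?_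
  have hs' : s + 1 ≤ t := Finset.mem_range.1 hs
  refine Measurable.ite ?_ ?_ measurable_const
  · exact MeasurableSet.inter (ℱ.mono (by omega) _ (hgame.measurable_choice s b))
      (ℱ.mono (by omega) _ (hgame.measurable_numPulls b s measurableSet_Iio))
  · exact hr.comp ((hgame.measurable_payoff (s + 1) (by omega)).mono (ℱ.mono hs') le_rfl)

/-- The stopped likelihood ratio is a nonnegative martingale, with expectation `1`. -/
lemma IsBanditGame.lintegral_stoppedLikelihood [IsProbabilityMeasure P] [DecidableEq 𝒜]
    (hgame : IsBanditGame P ν ℱ A Y) (b : 𝒜)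
    [IsProbabilityMeasure (ν b)] (k : ℕ) {r : ℝ → ℝ≥0∞} (hr : Measurable r)
    (hr1 : ∫⁻ y, r y ∂(ν b) = 1) (t : ℕ) :
    ∫⁻ ω, stoppedLikelihood A Y b k r t ω ∂P = 1 := by
  induction t with
  | zero => simp [stoppedLikelihood]
  | succ t ih =>
    set Z := stoppedLikelihood A Y b k r t with hZ
    have hZm : Measurable[ℱ t] Z := hgame.measurable_stoppedLikelihood b k hr t
    set D : Set Ω := {ω | A (t + 1) ω = b} with hD
    set N : Set Ω := {ω | numPulls A b t ω < k} with hN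
    have hDm : MeasurableSet D := ℱ.le t _ (hgame.measurable_choice t b)
    have hNm : MeasurableSet[ℱ t] N := hgame.measurable_numPulls b t measurableSet_Iio
    have hNm' : MeasurableSet N := ℱ.le t _ hNm
    have hYm : Measurable (Y (t + 1)) :=
      (hgame.measurable_payoff (t + 1) (by omega)).mono (ℱ.le _) le_rfl
    have hg : Measurable[ℱ t] (N.indicator Z) := hZm.indicator hNm
    have h1 := hgame.setLIntegral_mul_payoff t b hg hr
    rw [hr1, mul_one, ← hD] at h1
    have h2 : ∀ ω, stoppedLikelihood A Y b k r (t + 1) ω =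
        (D.indicator (fun ω => N.indicator Z ω * r (Y (t + 1) ω)) ω) +
          (D ∩ N)ᶜ.indicator Z ω := by
      intro ω
      rw [stoppedLikelihood, Finset.prod_range_succ, ← stoppedLikelihood, ← hZ]
      by_cases hωD : ω ∈ D <;> by_cases hωN : ω ∈ N
      · rw [if_pos ⟨hωD, hωN⟩]; simp [hωD, hωN]
      · rw [if_neg (fun h => hωN h.2)]; simp [hωD, hωN]
      · rw [if_neg (fun h => hωD h.1)]; simp [hωD]
      · rw [if_neg (fun h => hωD h.1)]; simp [hωD]
    have hm' : Measurable ((D ∩ N)ᶜ.indicator Z) :=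
      (hZm.mono (ℱ.le t) le_rfl).indicator (hDm.inter hNm').compl
    rw [lintegral_congr h2, lintegral_add_right _ hm', lintegral_indicator hDm, h1,
      ← lintegral_indicator hDm, ← lintegral_add_right _ hm', ← ih]
    refine lintegral_congr fun ω => ?_
    by_cases hωD : ω ∈ D <;> by_cases hωN : ω ∈ N <;> simp [hωD, hωN]

lemma IsBanditGame.measurableSet_typeEvent [DecidableEq 𝒜]
    (hgame : IsBanditGame P ν ℱ A Y) (b : 𝒜)
    (S : Finset ℝ) (T k : ℕ) (n : ℝ → ℕ) : MeasurableSet (typeEvent A Y b S T k n) := by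
  have hcount : ∀ t y, Measurable fun ω => payoffCount A Y b t ω y := by
    intro t y
    have : (fun ω => payoffCount A Y b t ω y) = fun ω =>
        ∑ s ∈ Finset.Icc 1 t, if A s ω = b ∧ Y s ω = y then 1 else 0 := by
      funext ω
      rw [payoffCount, pulls, Finset.filter_filter, Finset.card_filter]
    rw [this]
    refine Finset.measurable_sum _ fun s hs => ?_
    obtain ⟨s, rfl⟩ := Nat.exists_eq_add_of_le' (Finset.mem_Icc.1 hs).1
    refine Measurable.ite ?_ measurable_const measurable_const
    exact (ℱ.le _ _ (hgame.measurable_choice s b)).inter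
      (((hgame.measurable_payoff (s + 1) (by omega)).mono (ℱ.le _) le_rfl)
        (measurableSet_singleton y))
  have : typeEvent A Y b S T k n = ⋃ t ∈ Finset.range (T + 1),
      ({ω | numPulls A b t ω = k} ∩ ⋂ y ∈ S, {ω | payoffCount A Y b t ω y = n y}) := by
    ext ω
    simp only [typeEvent, Set.mem_ofPred_eq, Set.mem_iUnion, Set.mem_inter_iff, Set.mem_iInter,
      Finset.mem_range, Nat.lt_succ_iff, exists_prop]
  rw [this]
  refine Finset.measurableSet_biUnion _ fun t _ => MeasurableSet.inter ?_ ?_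
  · exact ((hgame.measurable_numPulls b t).mono (ℱ.le t) le_rfl) (measurableSet_singleton k)
  · exact Finset.measurableSet_biInter _ fun y _ => hcount t y (measurableSet_singleton _)

lemma IsBanditGame.likelihoodDominated [IsProbabilityMeasure P] [DecidableEq 𝒜]
    (hgame : IsBanditGame P ν ℱ A Y) (b : 𝒜)
    [IsProbabilityMeasure (ν b)] {S : Finset ℝ} (hS : ν b (S : Set ℝ)ᶜ = 0) (T k : ℕ) :
    LikelihoodDominated S k (fun y => (ν b).real {y})
      (fun n => P.real (typeEvent A Y b S T k n)) := by
  classical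
  intro r hr0 hr1
  set R : ℝ → ℝ≥0∞ := fun y => ∑ x ∈ S, ({x} : Set ℝ).indicator (fun _ => ENNReal.ofReal (r x)) y
    with hR
  have hRS : ∀ y ∈ S, R y = ENNReal.ofReal (r y) := by
    intro y hy
    simp [hR, Set.indicator_apply, hy]
  have hRm : Measurable R :=
    Finset.measurable_sum _ fun x _ => measurable_const.indicator (measurableSet_singleton x)
  have hR1 : ∫⁻ y, R y ∂(ν b) = 1 := by
    rw [lintegral_finsetSum _ fun x _ => measurable_const.indicator (measurableSet_singleton x)]
    simp only [lintegral_indicator_const (measurableSet_singleton _)]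
    rw [← ENNReal.ofReal_one, ← hr1, ENNReal.ofReal_sum_of_nonneg
      fun y hy => mul_nonneg measureReal_nonneg (hr0 y hy)]
    refine Finset.sum_congr rfl fun y hy => ?_
    rw [ENNReal.ofReal_mul measureReal_nonneg, ofReal_measureReal, mul_comm]
  have hmeas := fun n => hgame.measurableSet_typeEvent b S T k n
  have h1 : ∫⁻ ω, ∑ n ∈ S.piAntidiag k,
      (typeEvent A Y b S T k n).indicator (fun _ => ∏ y ∈ S, R y ^ n y) ω ∂P ≤ 1 := by
    rw [← hgame.lintegral_stoppedLikelihood b k hRm hR1 T]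
    refine lintegral_mono_ae ?_
    filter_upwards [hgame.ae_payoff_mem b hS] with ω hω
    by_cases hex : ∃ n ∈ S.piAntidiag k, ω ∈ typeEvent A Y b S T k n
    · obtain ⟨n, hn, hωn⟩ := hex
      rw [Finset.sum_eq_single n]
      · rw [Set.indicator_of_mem hωn]
        obtain ⟨t, htT, ht, hy⟩ := hωn
        rw [stoppedLikelihood_const R ht htT, stoppedLikelihood_eq_prod R ht.le,
          ← Finset.prod_fiberwise_of_maps_to (hω t)]
        refine le_of_eq (Finset.prod_congr rfl fun y hyS => ?_)
        rw [← hy y hyS, payoffCount, ← Finset.prod_const]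
        exact Finset.prod_congr rfl fun s hs => by rw [(Finset.mem_filter.1 hs).2]
      · intro n' hn' hne
        exact Set.indicator_of_notMem (fun h => hne (eq_of_mem_typeEvent hn' hn h hωn)) _
      · exact fun h => absurd hn h
    · push Not at hex
      rw [Finset.sum_eq_zero fun n hn => Set.indicator_of_notMem (hex n hn) _]
      exact zero_le
  rw [lintegral_finsetSum _ fun n _ => measurable_const.indicator (hmeas n)] at h1
  simp only [lintegral_indicator_const (hmeas _)] at h1
  rw [← ENNReal.ofReal_le_one]
  refine le_trans (le_of_eq ?_) h1
  rw [ENNReal.ofReal_sum_of_nonneg fun n _ => mul_nonneg measureReal_nonneg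
    (Finset.prod_nonneg fun y hy => pow_nonneg (hr0 y hy) _)]
  refine Finset.sum_congr rfl fun n _ => ?_
  rw [ENNReal.ofReal_mul measureReal_nonneg, ofReal_measureReal, mul_comm,
    ENNReal.ofReal_prod_of_nonneg fun y hy => pow_nonneg (hr0 y hy) _]
  congr 1
  refine Finset.prod_congr rfl fun y hy => ?_
  rw [hRS y hy, ENNReal.ofReal_pow (hr0 y hy)]

end Game

/-! ### Pathwise analysis of the strategy -/

section Index

variable {Ω : Type*} {𝒜 : Type*} [DecidableEq 𝒜] {A : ℕ → Ω → 𝒜} {Y : ℕ → Ω → ℝ} {b : 𝒜} {ω : Ω}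
  {f : ℕ → ℝ} {t : ℕ} {q : ℝ}

lemma coe_ennreal_le_coe_iff {r : ℝ≥0∞} (hr : r ≠ ∞) {x : ℝ} :
    (r : EReal) ≤ (x : EReal) ↔ r.toReal ≤ x := by
  rw [← EReal.coe_ennreal_toReal hr, EReal.coe_le_coe_iff]

lemma le_index (hemp : IsFinUnitDist (empDist A Y b t ω)) (hq0 : 0 ≤ q) (hq1 : q < 1)
    (h : numPulls A b t ω * (kInf (empDist A Y b t ω) q).toReal ≤ f t) :
    q ≤ index f A Y b t ω := by
  have hfin := (kInf_le_neg_log hemp hq0 hq1).1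
  refine le_csSup ⟨1, fun x hx => hx.1.2⟩ ⟨⟨hq0, hq1.le⟩, ?_⟩
  rw [coe_ennreal_le_coe_iff (ENNReal.mul_ne_top (by simp) hfin), ENNReal.toReal_mul]
  simpa using h

/-- The set that defines the index is closed below `1`, by the regularity of `kInf`. -/
lemma mul_kInf_le_of_le_index (hemp : IsFinUnitDist (empDist A Y b t ω)) (hq0 : 0 < q)
    (hq1 : q < 1) (h : q ≤ index f A Y b t ω) :
    numPulls A b t ω * (kInf (empDist A Y b t ω) q).toReal ≤ f t := by
  set N := numPulls A b t ω with hN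
  refine le_of_forall_pos_le_add fun δ hδ => ?_
  have h1q : 0 < 1 - q := by linarith
  set q' := max 0 (q - δ * (1 - q) / (N + 1)) with hq'
  have hq'0 : 0 ≤ q' := le_max_left _ _
  have hq'q : q' < q := max_lt hq0 (sub_lt_self _ (by positivity))
  have hne : {q : ℝ | q ∈ Set.Icc (0 : ℝ) 1 ∧
      (((numPulls A b t ω : ℝ≥0∞) * kInf (empDist A Y b t ω) q : ℝ≥0∞) : EReal) ≤
        (f t : EReal)}.Nonempty := by
    by_contra hemp'
    rw [Set.not_nonempty_iff_eq_empty] at hemp'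
    rw [index, hemp', Real.sSup_empty] at h
    linarith
  obtain ⟨x, ⟨hx, hxle⟩, hq'x⟩ := exists_lt_of_lt_csSup hne (hq'q.trans_le h)
  have hfin' := (kInf_le_neg_log hemp hq'0 (hq'q.trans hq1)).1
  have h1 : (((N : ℝ≥0∞) * kInf (empDist A Y b t ω) q' : ℝ≥0∞) : EReal) ≤ (f t : EReal) := by
    refine le_trans ?_ hxle
    rw [EReal.coe_ennreal_le_coe_ennreal_iff]
    exact mul_le_mul_right (kInf_mono hq'x.le) _
  rw [coe_ennreal_le_coe_iff (ENNReal.mul_ne_top (by simp) hfin'), ENNReal.toReal_mul,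
    ENNReal.toReal_natCast] at h1
  have hD : 0 ≤ (q - q') / (1 - q) := div_nonneg (by linarith) h1q.le
  have h2 := ENNReal.toReal_mono (by finiteness) (kInf_le_add hemp hq'q.le hq1)
  rw [ENNReal.toReal_add hfin' ENNReal.ofReal_ne_top, ENNReal.toReal_ofReal hD] at h2
  have h3 : (q - q') / (1 - q) ≤ δ / (N + 1) := by
    rw [div_le_iff₀ h1q]
    have := le_max_right 0 (q - δ * (1 - q) / (N + 1))
    have h4 : δ / (N + 1) * (1 - q) = δ * (1 - q) / (N + 1) := by ring
    linarith
  have h5 : (N : ℝ) * ((q - q') / (1 - q)) ≤ δ := by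
    have h6 : (N : ℝ) * (δ / (N + 1)) ≤ δ := by
      rw [← mul_div_assoc, div_le_iff₀ (by positivity)]
      nlinarith
    exact (mul_le_mul_of_nonneg_left h3 (Nat.cast_nonneg N)).trans h6
  have h7 := mul_le_mul_of_nonneg_left h2 (Nat.cast_nonneg (α := ℝ) N)
  linarith

lemma numPulls_eq_card_range (t : ℕ) :
    numPulls A b t ω = ((Finset.range t).filter fun s => A (s + 1) ω = b).card := by
  induction t with
  | zero => simp [numPulls_zero]
  | succ t ih =>
    rw [numPulls_succ, ih, Finset.range_add_one, Finset.filter_insert]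
    split_ifs with h
    · rw [Finset.card_insert_of_notMem (by simp)]
    · rfl

lemma eq_of_numPulls_eq {s t : ℕ} (hs : A (s + 1) ω = b) (ht : A (t + 1) ω = b)
    (h : numPulls A b s ω = numPulls A b t ω) : s = t := by
  by_contra hne
  rcases lt_or_gt_of_ne hne with h' | h'
  · have h1 := numPulls_mono (A := A) (b := b) (ω := ω) (show s + 1 ≤ t from h')
    have h2 := numPulls_succ (A := A) (b := b) (ω := ω) s
    rw [if_pos hs] at h2
    omega
  · have h1 := numPulls_mono (A := A) (b := b) (ω := ω) (show t + 1 ≤ s from h')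
    have h2 := numPulls_succ (A := A) (b := b) (ω := ω) t
    rw [if_pos ht] at h2
    omega

lemma card_le_of_lt {U : Finset ℕ} {x : ℝ} (hx0 : 0 ≤ x) (h1 : ∀ t ∈ U, 1 ≤ t)
    (hx : ∀ t ∈ U, (t : ℝ) < x) : (U.card : ℝ) ≤ x := by
  have hsub : U ⊆ Finset.Icc 1 ⌊x⌋₊ := fun t ht =>
    Finset.mem_Icc.2 ⟨h1 t ht, Nat.le_floor (hx t ht).le⟩
  have := Finset.card_le_card hsub
  rw [Nat.card_Icc, Nat.add_sub_cancel] at this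
  exact (Nat.cast_le.2 this).trans (Nat.floor_le hx0)

end Index

section Pathwise

variable {Ω : Type*} {𝒜 : Type*} [DecidableEq 𝒜] {A : ℕ → Ω → 𝒜} {Y : ℕ → Ω → ℝ} {b : 𝒜} {ω : Ω}

open Classical in
/-- The types of size `k` at which the index of a suboptimal arm can be large. -/
noncomputable def closeTypes (S : Finset ℝ) (k : ℕ) (q γ : ℝ) : Finset (ℝ → ℕ) :=
  (S.piAntidiag k).filter fun n => kInf (typeDist S k n) q < ENNReal.ofReal γ

open Classical in
/-- The types of size `k` with expectation at most `q`; at the others `kInf` vanishes. -/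
noncomputable def lowTypes (S : Finset ℝ) (k : ℕ) (q : ℝ) : Finset (ℝ → ℕ) :=
  (S.piAntidiag k).filter fun n => mean (typeDist S k n) ≤ q

lemma exists_type {S : Finset ℝ} {t T : ℕ} (htT : t ≤ T) (ht : numPulls A b t ω ≠ 0)
    (hY : ∀ s ∈ pulls A b t ω, Y s ω ∈ S) :
    ∃ n ∈ S.piAntidiag (numPulls A b t ω), ω ∈ typeEvent A Y b S T (numPulls A b t ω) n ∧
      empDist A Y b t ω = typeDist S (numPulls A b t ω) n := by
  have hy : ∀ y ∈ S, payoffCount A Y b t ω y = if y ∈ S then payoffCount A Y b t ω y else 0 :=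
    fun y hy => (if_pos hy).symm
  exact ⟨_, payoffCount_mem_piAntidiag hY, ⟨t, htT, rfl, hy⟩, empDist_eq_typeDist ht rfl hY hy⟩

lemma card_filter_kInf_lt_le {S : Finset ℝ} {T k₀ : ℕ} (hk₀ : 1 ≤ k₀) {q γ : ℝ}
    (hY : ∀ t, ∀ s ∈ pulls A b t ω, Y s ω ∈ S) {U : Finset ℕ} (hU : U ⊆ Finset.range T)
    (hA : ∀ t ∈ U, A (t + 1) ω = b) (hk : ∀ t ∈ U, k₀ ≤ numPulls A b t ω)
    (hlt : ∀ t ∈ U, kInf (empDist A Y b t ω) q < ENNReal.ofReal γ) :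
    (U.card : ℝ) ≤ ∑ k ∈ Finset.Icc k₀ T, ∑ n ∈ closeTypes S k q γ,
      (typeEvent A Y b S T k n).indicator (fun _ => (1 : ℝ)) ω := by
  have hmaps : ∀ t ∈ U, numPulls A b t ω ∈ Finset.Icc k₀ T := fun t ht =>
    Finset.mem_Icc.2 ⟨hk t ht, (numPulls_le t).trans (Finset.mem_range.1 (hU ht)).le⟩
  rw [Finset.card_eq_sum_card_fiberwise hmaps, Nat.cast_sum]
  refine Finset.sum_le_sum fun k hkT => ?_
  have hnn : ∀ n ∈ closeTypes S k q γ,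
      0 ≤ (typeEvent A Y b S T k n).indicator (fun _ => (1 : ℝ)) ω :=
    fun n _ => Set.indicator_nonneg (fun _ _ => zero_le_one) _
  rcases (U.filter fun t => numPulls A b t ω = k).eq_empty_or_nonempty with h | ⟨t, ht⟩
  · rw [h]
    simpa using Finset.sum_nonneg hnn
  obtain ⟨htU, rfl⟩ := Finset.mem_filter.1 ht
  have h1 : (U.filter fun s => numPulls A b s ω = numPulls A b t ω).card ≤ 1 := by
    refine Finset.card_le_one.2 fun s hs s' hs' => ?_
    obtain ⟨hs, hse⟩ := Finset.mem_filter.1 hs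
    obtain ⟨hs', hse'⟩ := Finset.mem_filter.1 hs'
    exact eq_of_numPulls_eq (hA s hs) (hA s' hs') (hse.trans hse'.symm)
  obtain ⟨n, hn, hev, hemp⟩ := exists_type (Finset.mem_range.1 (hU htU)).le
    (by have := hk t htU; omega) (hY t)
  have hnc : n ∈ closeTypes S (numPulls A b t ω) q γ :=
    Finset.mem_filter.2 ⟨hn, hemp ▸ hlt t htU⟩
  refine le_trans ?_ (Finset.single_le_sum hnn hnc)
  rw [Set.indicator_of_mem hev]
  exact_mod_cast h1

/-- While arm `b` has been pulled `k` times and its empirical distribution is `n / k`, the rounds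
`t` with `log t < k kInf (n / k) q` are at most `exp (k kInf (n / k) q)` many. -/
lemma card_filter_log_lt_le {S : Finset ℝ} (hS : ∀ y ∈ S, y ∈ Set.Icc (0 : ℝ) 1) {T : ℕ} {q : ℝ}
    (hY : ∀ t, ∀ s ∈ pulls A b t ω, Y s ω ∈ S) {U : Finset ℕ} (hU : U ⊆ Finset.range T)
    (h1 : ∀ t ∈ U, 1 ≤ t) (hk : ∀ t ∈ U, 1 ≤ numPulls A b t ω)
    (hlt : ∀ t ∈ U, Real.log t < numPulls A b t ω * (kInf (empDist A Y b t ω) q).toReal) :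
    (U.card : ℝ) ≤ ∑ k ∈ Finset.Icc 1 T, ∑ n ∈ lowTypes S k q,
      (typeEvent A Y b S T k n).indicator
        (fun _ => Real.exp (k * (kInf (typeDist S k n) q).toReal)) ω := by
  have hmaps : ∀ t ∈ U, numPulls A b t ω ∈ Finset.Icc 1 T := fun t ht =>
    Finset.mem_Icc.2 ⟨hk t ht, (numPulls_le t).trans (Finset.mem_range.1 (hU ht)).le⟩
  rw [Finset.card_eq_sum_card_fiberwise hmaps, Nat.cast_sum]
  refine Finset.sum_le_sum fun k hkT => ?_
  have hnn : ∀ n ∈ lowTypes S k q, 0 ≤ (typeEvent A Y b S T k n).indicator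
      (fun _ => Real.exp (k * (kInf (typeDist S k n) q).toReal)) ω :=
    fun n _ => Set.indicator_nonneg (fun _ _ => (Real.exp_pos _).le) _
  rcases (U.filter fun t => numPulls A b t ω = k).eq_empty_or_nonempty with h | ⟨t, ht⟩
  · rw [h]
    simpa using Finset.sum_nonneg hnn
  obtain ⟨htU, rfl⟩ := Finset.mem_filter.1 ht
  have hne : numPulls A b t ω ≠ 0 := by have := hk t htU; omega
  obtain ⟨n, hn, hev, hemp⟩ := exists_type (Finset.mem_range.1 (hU htU)).le hne (hY t)
  have hnc : n ∈ lowTypes S (numPulls A b t ω) q := by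
    refine Finset.mem_filter.2 ⟨hn, ?_⟩
    by_contra! hq
    have h2 := hlt t htU
    rw [hemp, kInf_eq_zero_of_lt_mean (isFinUnitDist_typeDist hS hne hn) hq] at h2
    simp only [ENNReal.toReal_zero, mul_zero] at h2
    have := Real.log_nonneg (show (1 : ℝ) ≤ t by exact_mod_cast h1 t htU)
    linarith
  refine le_trans ?_ (Finset.single_le_sum hnn hnc)
  rw [Set.indicator_of_mem hev]
  refine card_le_of_lt (Real.exp_pos _).le (fun s hs => h1 s (Finset.mem_filter.1 hs).1)
    fun s hs => ?_
  obtain ⟨hsU, hse⟩ := Finset.mem_filter.1 hs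
  have h3 : (0 : ℝ) < s := by exact_mod_cast h1 s hsU
  rw [← Real.log_lt_iff_lt_exp h3]
  have h4 := hlt s hsU
  have h5 : empDist A Y b s ω = empDist A Y b t ω := by
    rw [empDist, empDist, hse, pulls_eq_of_numPulls_eq hse]
  rwa [h5, hemp, hse] at h4

lemma isFinUnitDist_empDist {S : Finset ℝ} (hS : ∀ y ∈ S, y ∈ Set.Icc (0 : ℝ) 1) {t : ℕ}
    (ht : numPulls A b t ω ≠ 0) (hY : ∀ s ∈ pulls A b t ω, Y s ω ∈ S) :
    IsFinUnitDist (empDist A Y b t ω) := by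
  obtain ⟨n, hn, -, hemp⟩ := exists_type le_rfl ht hY
  rw [hemp]
  exact isFinUnitDist_typeDist hS ht hn

/-- Beyond `k₀` pulls of arm `a`, each further pull at a round `t + 1` happens either while `kInf`
of its empirical distribution is below `γ`, or while `log t < N_t(b) kInf(ν̂_b, q)`, which means
that the inequality defining the index of arm `b` fails at `q`. -/
lemma numPulls_le_add_sums [Fintype 𝒜] {a : 𝒜} {Sa Sb : Finset ℝ}
    (hSa : ∀ y ∈ Sa, y ∈ Set.Icc (0 : ℝ) 1) (hSb : ∀ y ∈ Sb, y ∈ Set.Icc (0 : ℝ) 1)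
    (hYa : ∀ t, ∀ s ∈ pulls A a t ω, Y s ω ∈ Sa) (hYb : ∀ t, ∀ s ∈ pulls A b t ω, Y s ω ∈ Sb)
    (hinit : ∀ b, numPulls A b (Fintype.card 𝒜) ω = 1)
    (hmax : ∀ t, Fintype.card 𝒜 ≤ t → ∀ b, index (fun t => Real.log t) A Y b t ω ≤
      index (fun t => Real.log t) A Y (A (t + 1) ω) t ω)
    {q μs γ : ℝ} (hq0 : 0 < q) (hqμ : q ≤ μs) (hμs : μs < 1) {T k₀ : ℕ} (hk₀ : 1 ≤ k₀)
    (hγ : γ = Real.log T / k₀ + (μs - q) / (1 - μs)) :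
    (numPulls A a T ω : ℝ) ≤ k₀
      + ∑ k ∈ Finset.Icc k₀ T, ∑ n ∈ closeTypes Sa k μs γ,
          (typeEvent A Y a Sa T k n).indicator (fun _ => (1 : ℝ)) ω
      + ∑ k ∈ Finset.Icc 1 T, ∑ n ∈ lowTypes Sb k q,
          (typeEvent A Y b Sb T k n).indicator
            (fun _ => Real.exp (k * (kInf (typeDist Sb k n) q).toReal)) ω := by
  classical
  have hcard : 1 ≤ Fintype.card 𝒜 := Fintype.card_pos_iff.2 ⟨a⟩
  set V := (Finset.range T).filter fun t => A (t + 1) ω = a with hV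
  set V₀ := V.filter fun t => numPulls A a t ω < k₀ with hV₀
  set U := V.filter fun t => ¬ numPulls A a t ω < k₀ with hU
  set U₁ := U.filter fun t => kInf (empDist A Y a t ω) μs < ENNReal.ofReal γ with hU₁
  set U₂ := U.filter fun t => ¬ kInf (empDist A Y a t ω) μs < ENNReal.ofReal γ with hU₂
  have hVT : V ⊆ Finset.range T := Finset.filter_subset _ _
  have hUV : U ⊆ V := Finset.filter_subset _ _
  have hUprop : ∀ t ∈ U, t < T ∧ A (t + 1) ω = a ∧ k₀ ≤ numPulls A a t ω := by
    intro t ht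
    obtain ⟨h1, h2⟩ := Finset.mem_filter.1 ht
    obtain ⟨h3, h4⟩ := Finset.mem_filter.1 h1
    exact ⟨Finset.mem_range.1 h3, h4, not_lt.1 h2⟩
  -- arm `a` is pulled once during the initialization, hence a later pull comes after it
  have hUcard : ∀ t ∈ U, Fintype.card 𝒜 ≤ t := by
    intro t ht
    obtain ⟨-, hA, hk⟩ := hUprop t ht
    by_contra! h
    have h1 := numPulls_mono (A := A) (b := a) (ω := ω) (show t + 1 ≤ _ from h)
    have h2 := numPulls_succ (A := A) (b := a) (ω := ω) t
    rw [if_pos hA] at h2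
    have := hinit a
    omega
  have hVcard : numPulls A a T ω = V₀.card + (U₁.card + U₂.card) := by
    rw [hU₁, hU₂, Finset.card_filter_add_card_filter_not, hV₀, hU,
      Finset.card_filter_add_card_filter_not]
    exact numPulls_eq_card_range T
  have hV₀card : V₀.card ≤ k₀ := by
    rw [← Finset.card_range k₀]
    refine Finset.card_le_card_of_injOn (fun t => numPulls A a t ω) (fun t ht => ?_) ?_
    · simpa using (Finset.mem_filter.1 (Finset.mem_coe.1 ht)).2
    · intro s hs t ht h
      exact eq_of_numPulls_eq
        (Finset.mem_filter.1 (Finset.mem_filter.1 (Finset.mem_coe.1 hs)).1).2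
        (Finset.mem_filter.1 (Finset.mem_filter.1 (Finset.mem_coe.1 ht)).1).2 h
  have hU₁U : ∀ t ∈ U₁, t ∈ U := fun t ht => (Finset.mem_filter.1 ht).1
  have hU₂U : ∀ t ∈ U₂, t ∈ U := fun t ht => (Finset.mem_filter.1 ht).1
  have hbpull : ∀ t ∈ U, 1 ≤ numPulls A b t ω := fun t ht =>
    (hinit b).ge.trans (numPulls_mono (hUcard t ht))
  have h1 := card_filter_kInf_lt_le (A := A) (Y := Y) (b := a) (ω := ω) (S := Sa) (T := T) hk₀
    (q := μs) (γ := γ) hYa (U := U₁) (fun t ht => hVT (hUV (hU₁U t ht)))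
    (fun t ht => (hUprop t (hU₁U t ht)).2.1) (fun t ht => (hUprop t (hU₁U t ht)).2.2)
    (fun t ht => (Finset.mem_filter.1 ht).2)
  have h2 := card_filter_log_lt_le (A := A) (Y := Y) (b := b) (ω := ω) hSb (T := T) (q := q) hYb
    (U := U₂) (fun t ht => hVT (hUV (hU₂U t ht)))
    (fun t ht => hcard.trans (hUcard t (hU₂U t ht))) (fun t ht => hbpull t (hU₂U t ht)) (by
      intro t ht
      obtain ⟨htU, hnot⟩ := Finset.mem_filter.1 ht
      obtain ⟨htT, hA, hk⟩ := hUprop t htU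
      by_contra! hle
      refine hnot ?_
      have hqlt : q < 1 := hqμ.trans_lt hμs
      have hN : 1 ≤ numPulls A a t ω := hk₀.trans hk
      have ht1 : 1 ≤ t := hcard.trans (hUcard t htU)
      have hempa := isFinUnitDist_empDist (A := A) (Y := Y) (b := a) (ω := ω) (t := t) hSa
        (by omega) (hYa t)
      have hempb := isFinUnitDist_empDist (A := A) (Y := Y) (b := b) (ω := ω) (t := t) hSb
        (by have := hbpull t htU; omega) (hYb t)
      have hidx := le_index (f := fun t => Real.log t) hempb hq0.le hqlt hle
      have hidx' := hidx.trans (hmax t (hUcard t htU) b)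
      rw [hA] at hidx'
      have h3 := mul_kInf_le_of_le_index hempa hq0 hqlt hidx'
      have hfin := (kInf_le_neg_log hempa hq0.le hqlt).1
      have h4 := kInf_le_add hempa hqμ hμs
      refine h4.trans_lt ?_
      have hD : 0 ≤ (μs - q) / (1 - μs) := div_nonneg (by linarith) (by linarith)
      rw [← ENNReal.ofReal_toReal hfin, ← ENNReal.ofReal_add ENNReal.toReal_nonneg hD, hγ]
      have hN' : (0 : ℝ) < numPulls A a t ω := by exact_mod_cast hN
      have hk₀' : (0 : ℝ) < k₀ := by exact_mod_cast hk₀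
      have ht' : (1 : ℝ) ≤ t := by exact_mod_cast ht1
      have h5 : (kInf (empDist A Y a t ω) q).toReal ≤ Real.log t / numPulls A a t ω := by
        rw [le_div_iff₀ hN']
        linarith
      have h6 : Real.log t / numPulls A a t ω ≤ Real.log t / k₀ :=
        div_le_div_of_nonneg_left (Real.log_nonneg ht') hk₀' (by exact_mod_cast hk)
      have h7 : Real.log t / k₀ < Real.log T / k₀ :=
        div_lt_div_of_pos_right (Real.log_lt_log (by linarith) (by exact_mod_cast htT)) hk₀'
      have h8 : (kInf (empDist A Y a t ω) q).toReal < Real.log T / k₀ := by linarith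
      refine (ENNReal.ofReal_lt_ofReal_iff ?_).2 (by linarith)
      have := ENNReal.toReal_nonneg (a := kInf (empDist A Y a t ω) q)
      linarith)
  have h3 : (V₀.card : ℝ) ≤ k₀ := by exact_mod_cast hV₀card
  rw [hVcard]
  push_cast
  linarith

end Pathwise

/-! ### Bound on the expected number of pulls -/

lemma real_singleton_pos {ν : Measure ℝ} [IsFiniteMeasure ν] (hfin : ν.support.Finite)
    {y : ℝ} (hy : y ∈ ν.support) :
    0 < ν.real {y} := by
  -- `y` has a neighbourhood without other points of the support
  have hU : (ν.support \ {y})ᶜ ∈ nhds y :=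
    (hfin.subset Set.sdiff_subset).isClosed.isOpen_compl.mem_nhds (by simp)
  have hpos := (Measure.mem_support_iff_forall y).1 hy _ hU
  have hsub : (ν.support \ {y})ᶜ ⊆ {y} ∪ ν.supportᶜ := by
    intro x hx
    by_cases hxy : x = y
    · simp [hxy]
    · exact Or.inr fun hxs => hx ⟨hxs, hxy⟩
  have hle := (measure_mono (μ := ν) hsub).trans (measure_union_le {y} ν.supportᶜ)
  rw [Measure.measure_compl_support, add_zero] at hle
  exact ENNReal.toReal_pos (hpos.trans_le hle).ne' (measure_ne_top _ _)

lemma toReal_exp_neg_lt_one {x : ℝ≥0∞} (hx : 0 < x) : (EReal.exp (-(x : EReal))).toReal < 1 := by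
  have h : EReal.exp (-(x : EReal)) < 1 := by
    rw [← EReal.exp_zero, EReal.exp_lt_exp_iff, EReal.neg_lt_comm, neg_zero]
    exact_mod_cast hx
  simpa using (ENNReal.toReal_lt_toReal h.ne_top ENNReal.one_ne_top).2 h

section Expectation

variable {Ω : Type*} [mΩ : MeasurableSpace Ω] {P : Measure Ω} [IsProbabilityMeasure P] {𝒜 : Type*}
  [DecidableEq 𝒜] {ν : 𝒜 → Measure ℝ} {ℱ : Filtration ℕ mΩ} {A : ℕ → Ω → 𝒜} {Y : ℕ → Ω → ℝ}

lemma IsBanditGame.sum_closeTypes_le (hgame : IsBanditGame P ν ℱ A Y) {b : 𝒜}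
    [IsProbabilityMeasure (ν b)] {S : Finset ℝ} (hνS : ν b (S : Set ℝ)ᶜ = 0)
    (hS : ∀ y ∈ S, y ∈ Set.Icc (0 : ℝ) 1) (hp : ∀ y ∈ S, 0 < (ν b).real {y}) (T k : ℕ)
    (hk : k ≠ 0) (q γ : ℝ) :
    ∑ n ∈ closeTypes S k q γ, P.real (typeEvent A Y b S T k n) ≤
      (EReal.exp (-(theta (ν b) q γ : EReal))).toReal ^ k := by
  have hnn : ∀ n, 0 ≤ P.real (typeEvent A Y b S T k n) := fun n => measureReal_nonneg
  rcases (Finset.sum_nonneg fun n (_ : n ∈ closeTypes S k q γ) => hnn n).eq_or_lt with h | h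
  · rw [← h]; positivity
  obtain ⟨hfin, hle⟩ := (hgame.likelihoodDominated b hνS T k).sum_le_exp_theta hk hp hnn hS
    (Finset.filter_subset _ _) (fun n hn => (Finset.mem_filter.1 hn).2) h
  refine hle.trans (le_of_eq ?_)
  rw [← EReal.coe_ennreal_toReal hfin, ← EReal.coe_neg, EReal.exp_coe,
    ENNReal.toReal_ofReal (Real.exp_pos _).le, ← Real.exp_nat_mul]
  congr 1
  ring

lemma IsBanditGame.sum_lowTypes_le (hgame : IsBanditGame P ν ℱ A Y) {b : 𝒜}
    [IsProbabilityMeasure (ν b)] {S : Finset ℝ} (hνS : ν b (S : Set ℝ)ᶜ = 0)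
    (hS : ∀ y ∈ S, y ∈ Set.Icc (0 : ℝ) 1) (hp : ∀ y ∈ S, 0 < (ν b).real {y}) (T k : ℕ)
    (hk : k ≠ 0) {q ε : ℝ} (hε : 0 < ε) (hq : q + ε ≤ mean (ν b)) :
    ∑ n ∈ lowTypes S k q, P.real (typeEvent A Y b S T k n) *
        Real.exp (k * (kInf (typeDist S k n) q).toReal) ≤
      ((k : ℝ) + 1) ^ S.card * Real.exp (-(k : ℝ) * ε ^ 2) := by
  have hsub : lowTypes S k q ⊆ S.piAntidiag k := Finset.filter_subset _ _
  have hterm : ∀ n ∈ lowTypes S k q, P.real (typeEvent A Y b S T k n) *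
      Real.exp (k * (kInf (typeDist S k n) q).toReal) ≤ Real.exp (-(k : ℝ) * ε ^ 2) := by
    intro n hn
    have hmean := (Finset.mem_filter.1 hn).2
    obtain ⟨hfin, hle⟩ := (hgame.likelihoodDominated b hνS T k).le_exp_klDiv hk hp
      (fun n => measureReal_nonneg) (hsub hn)
    have h1 := kInf_add_sq_le_klDiv (isFinUnitDist_typeDist hS hk (hsub hn))
      (isFinUnitDist_of_finset hS hνS) hε hmean hq hfin
    refine (mul_le_mul_of_nonneg_right hle (Real.exp_pos _).le).trans ?_
    rw [← Real.exp_add, Real.exp_le_exp]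
    have h2 := mul_le_mul_of_nonneg_left h1 (Nat.cast_nonneg (α := ℝ) k)
    linarith
  refine (Finset.sum_le_sum hterm).trans ?_
  rw [Finset.sum_const, nsmul_eq_mul]
  refine mul_le_mul_of_nonneg_right ?_ (Real.exp_pos _).le
  exact_mod_cast (Finset.card_le_card hsub).trans (card_piAntidiag_le S k)

lemma sum_Icc_pow_le {x : ℝ} (hx0 : 0 ≤ x) (hx1 : x < 1) (k T : ℕ) :
    ∑ j ∈ Finset.Icc k T, x ^ j ≤ 1 / (1 - x) := by
  rw [one_div, ← tsum_geometric_of_lt_one hx0 hx1]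
  exact (summable_geometric_of_lt_one hx0 hx1).sum_le_tsum _ fun j _ => pow_nonneg hx0 j

/-- The bound on the expected number of pulls with an arbitrary threshold `k₀` on the number of
pulls of arm `a` and an arbitrary level `q` at which the indices are compared. -/
lemma IsBanditGame.integral_numPulls_le [Fintype 𝒜] (hgame : IsBanditGame P ν ℱ A Y)
    (hstrategy : FollowsKinf P (fun t => Real.log t) A Y) {a b : 𝒜}
    (hνa : IsFinUnitDist (ν a)) (hνb : IsFinUnitDist (ν b)) {q μs γ ε : ℝ} (hq0 : 0 < q)
    (hqμ : q ≤ μs) (hμs : μs < 1) (hε : 0 < ε) (hq : q + ε ≤ mean (ν b)) {T k₀ : ℕ}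
    (hk₀ : 1 ≤ k₀) (hγ : γ = Real.log T / k₀ + (μs - q) / (1 - μs))
    (hθ : 0 < theta (ν a) μs γ) :
    ∫ ω, (numPulls A a T ω : ℝ) ∂P ≤ k₀
      + 1 / (1 - (EReal.exp (-(theta (ν a) μs γ : EReal))).toReal)
      + ∑ k ∈ Finset.Icc 1 T,
          ((k : ℝ) + 1) ^ (ν b).support.ncard * Real.exp (-(k : ℝ) * ε ^ 2) := by
  have := hνa.isProb
  have := hνb.isProb
  set Sa := hνa.finite_support.toFinset with hSa
  set Sb := hνb.finite_support.toFinset with hSb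
  have hSa01 : ∀ y ∈ Sa, y ∈ Set.Icc (0 : ℝ) 1 := fun y hy =>
    hνa.support_subset (by simpa [hSa] using hy)
  have hSb01 : ∀ y ∈ Sb, y ∈ Set.Icc (0 : ℝ) 1 := fun y hy =>
    hνb.support_subset (by simpa [hSb] using hy)
  have hνSa : ν a (Sa : Set ℝ)ᶜ = 0 := by simp [hSa]
  have hνSb : ν b (Sb : Set ℝ)ᶜ = 0 := by simp [hSb]
  have hpa : ∀ y ∈ Sa, 0 < (ν a).real {y} := fun y hy =>
    real_singleton_pos hνa.finite_support (by simpa [hSa] using hy)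
  have hpb : ∀ y ∈ Sb, 0 < (ν b).real {y} := fun y hy =>
    real_singleton_pos hνb.finite_support (by simpa [hSb] using hy)
  have hcard : (ν b).support.ncard = Sb.card := Set.ncard_eq_toFinset_card _ _
  have hpath : ∀ᵐ ω ∂P, (numPulls A a T ω : ℝ) ≤ k₀
      + ∑ k ∈ Finset.Icc k₀ T, ∑ n ∈ closeTypes Sa k μs γ,
          (typeEvent A Y a Sa T k n).indicator (fun _ => (1 : ℝ)) ω
      + ∑ k ∈ Finset.Icc 1 T, ∑ n ∈ lowTypes Sb k q,
          (typeEvent A Y b Sb T k n).indicator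
            (fun _ => Real.exp (k * (kInf (typeDist Sb k n) q).toReal)) ω := by
    filter_upwards [hgame.ae_payoff_mem a hνSa, hgame.ae_payoff_mem b hνSb, hstrategy]
      with ω hωa hωb hω
    exact numPulls_le_add_sums hSa01 hSb01 hωa hωb hω.1 (fun t ht => (hω.2 t ht).1) hq0 hqμ hμs
      hk₀ hγ
  have hint : ∀ (c : 𝒜) (S : Finset ℝ) (k : ℕ) (n : ℝ → ℕ) (x : ℝ),
      Integrable ((typeEvent A Y c S T k n).indicator fun _ => x) P := fun c S k n x =>
    (integrable_const x).indicator (hgame.measurableSet_typeEvent c S T k n)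
  have hintN : Integrable (fun ω => (numPulls A a T ω : ℝ)) P := by
    refine Integrable.of_mem_Icc 0 T ?_ (Filter.Eventually.of_forall fun ω =>
      ⟨Nat.cast_nonneg _, Nat.cast_le.2 (numPulls_le T)⟩)
    exact (measurable_from_top.comp
      ((hgame.measurable_numPulls a T).mono (ℱ.le T) le_rfl)).aemeasurable
  have hint₁ : Integrable (fun ω => ∑ k ∈ Finset.Icc k₀ T, ∑ n ∈ closeTypes Sa k μs γ,
      (typeEvent A Y a Sa T k n).indicator (fun _ => (1 : ℝ)) ω) P :=
    integrable_finsetSum _ fun k _ => integrable_finsetSum _ fun n _ => hint a Sa k n 1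
  have hint₂ : Integrable (fun ω => ∑ k ∈ Finset.Icc 1 T, ∑ n ∈ lowTypes Sb k q,
      (typeEvent A Y b Sb T k n).indicator
        (fun _ => Real.exp (k * (kInf (typeDist Sb k n) q).toReal)) ω) P :=
    integrable_finsetSum _ fun k _ => integrable_finsetSum _ fun n _ => hint b Sb k n _
  have hx1 := toReal_exp_neg_lt_one hθ
  refine (integral_mono_ae hintN (((integrable_const _).add hint₁).add hint₂) hpath).trans ?_
  rw [integral_add' ((integrable_const _).add hint₁) hint₂,
    integral_add' (integrable_const _) hint₁,
    integral_const, probReal_univ, one_smul,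
    integral_finsetSum _ fun k _ => integrable_finsetSum _ fun n _ => hint a Sa k n 1,
    integral_finsetSum _ fun k _ => integrable_finsetSum _ fun n _ => hint b Sb k n _]
  refine add_le_add (add_le_add le_rfl ?_) ?_
  · refine le_trans (Finset.sum_le_sum fun k hk => ?_)
      (sum_Icc_pow_le ENNReal.toReal_nonneg hx1 k₀ T)
    rw [integral_finsetSum _ fun n _ => hint a Sa k n 1]
    simp only [integral_indicator_const _ (hgame.measurableSet_typeEvent _ _ _ _ _), smul_eq_mul,
      mul_one]
    exact hgame.sum_closeTypes_le hνSa hSa01 hpa T k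
      (by have := (Finset.mem_Icc.1 hk).1; omega) μs γ
  · refine Finset.sum_le_sum fun k hk => ?_
    rw [integral_finsetSum _ fun n _ => hint b Sb k n _, hcard]
    simp only [integral_indicator_const _ (hgame.measurableSet_typeEvent _ _ _ _ _), smul_eq_mul]
    exact hgame.sum_lowTypes_le hνSb hSb01 hpb T k
      (by have := (Finset.mem_Icc.1 hk).1; omega) hε hq

end Expectation

end KinfBandit

theorem theorem2 {Ω : Type*} [mΩ : MeasurableSpace Ω] (P : Measure Ω) [IsProbabilityMeasure P]
    {𝒜 : Type*} [Fintype 𝒜] [DecidableEq 𝒜]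
    (ν : 𝒜 → Measure ℝ) (hν : ∀ b, KinfBandit.IsUnitDist (ν b))
    (ℱ : Filtration ℕ mΩ) (A : ℕ → Ω → 𝒜) (Y : ℕ → Ω → ℝ)
    (hgame : KinfBandit.IsBanditGame P ν ℱ A Y)
    (hstrategy : KinfBandit.FollowsKinf P (fun t => Real.log t) A Y)
    (astar : 𝒜) (μs : ℝ) (hμs : μs = KinfBandit.mean (ν astar))
    (hopt : ∀ b, KinfBandit.mean (ν b) ≤ μs)
    (hμs01 : μs ∈ Set.Ioo (0 : ℝ) 1) (hfin_star : (ν astar).support.Finite)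
    (a : 𝒜) (μa : ℝ) (hμa : μa = KinfBandit.mean (ν a))
    (hsub : μa < μs) (hμa_pos : 0 < μa) (hfin_a : (ν a).support.Finite)
    (c : ℝ) (hc : 0 < c) (ε : ℝ) (hε_pos : 0 < ε)
    (hε : ε < min (μs - μa)
      ((c / 2) / (1 + c) * (1 - μs) * (KinfBandit.kInf (ν a) μs).toReal))
    (T : ℕ) (hT : 1 ≤ T) :
    0 < KinfBandit.bigTheta (ν a) μs c ε T ∧
    ∫ ω, (KinfBandit.numPulls A a T ω : ℝ) ∂P ≤
      1 + (1 + c) * Real.log T / (KinfBandit.kInf (ν a) μs).toReal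
      + 1 / (1 - (EReal.exp (-(KinfBandit.bigTheta (ν a) μs c ε T : EReal))).toReal)
      + 1 / ε ^ 2 * Real.log (1 / (1 - μs + ε)) *
          ∑ k ∈ Finset.Icc 1 T,
            ((k : ℝ) + 1) ^ (ν astar).support.ncard * Real.exp (-(k : ℝ) * ε ^ 2)
      + 1 / (μs - μa - ε) ^ 2 := by
  obtain ⟨hμs0, hμs1⟩ := hμs01
  have hνa : KinfBandit.IsFinUnitDist (ν a) := ⟨hν a, hfin_a⟩
  have hνs : KinfBandit.IsFinUnitDist (ν astar) := ⟨hν astar, hfin_star⟩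
  obtain ⟨hεΔ, hεK⟩ := lt_min_iff.1 hε
  obtain ⟨-, hKle⟩ := KinfBandit.kInf_le_neg_log hνa hμs0.le hμs1
  set K := (KinfBandit.kInf (ν a) μs).toReal with hK
  have h1μ : 0 < 1 - μs := by linarith
  have hK0 : 0 < K := by
    by_contra! h
    have : (c / 2) / (1 + c) * (1 - μs) * K ≤ 0 := mul_nonpos_of_nonneg_of_nonpos (by positivity) h
    linarith
  have hlogT : 0 ≤ Real.log T := Real.log_nonneg (by exact_mod_cast hT)
  set k₀ := KinfBandit.kZero (ν a) μs c T with hk₀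
  have hk₀le : (1 + c) * Real.log T / K ≤ k₀ := Nat.le_ceil _
  set γ := Real.log T / k₀ + ε / (1 - μs) with hγ
  have hγK : γ < K := by
    have h1 : Real.log T / k₀ ≤ K / (1 + c) := by
      refine div_le_of_le_mul₀ (Nat.cast_nonneg _) (by positivity) ?_
      rw [div_le_iff₀ hK0] at hk₀le
      rw [div_mul_eq_mul_div, le_div_iff₀ (by linarith)]
      linarith
    have h2 : ε / (1 - μs) < (c / 2) / (1 + c) * K := by
      rw [div_lt_iff₀ h1μ]
      linarith
    have h3 : K / (1 + c) + (c / 2) / (1 + c) * K < K := by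
      have h4 : K / (1 + c) + (c / 2) / (1 + c) * K = K * (1 + c / 2) / (1 + c) := by ring
      rw [h4, div_lt_iff₀ (by linarith)]
      nlinarith
    linarith
  have hΘ : 0 < KinfBandit.bigTheta (ν a) μs c ε T := KinfBandit.theta_pos hνa hμs0 hμs1 hγK
  refine ⟨hΘ, ?_⟩
  have hlast : 0 ≤ 1 / (μs - μa - ε) ^ 2 := by positivity
  have hsum : 0 ≤ ∑ k ∈ Finset.Icc 1 T,
      ((k : ℝ) + 1) ^ (ν astar).support.ncard * Real.exp (-(k : ℝ) * ε ^ 2) :=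
    Finset.sum_nonneg fun k _ => by positivity
  -- `ε < μs / 2`, because `kInf (ν a) μs ≤ -log (1 - μs) ≤ μs / (1 - μs)`
  have hεμ : ε < μs / 2 := by
    have h1 : (1 - μs) * K ≤ μs := by
      have h2 := Real.log_le_sub_one_of_pos (show 0 < (1 - μs)⁻¹ by positivity)
      rw [Real.log_inv] at h2
      have h3 := mul_le_mul_of_nonneg_left (hKle.trans h2) h1μ.le
      rw [mul_sub, mul_inv_cancel₀ h1μ.ne'] at h3
      linarith
    have h4 : (c / 2) / (1 + c) ≤ 1 / 2 := by
      rw [div_le_iff₀ (by linarith)]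
      linarith
    have h5 : (c / 2) / (1 + c) * ((1 - μs) * K) ≤ 1 / 2 * μs :=
      mul_le_mul h4 h1 (by positivity) (by norm_num)
    linarith
  have hfactor : 1 ≤ 1 / ε ^ 2 * Real.log (1 / (1 - μs + ε)) := by
    have h1 := Real.log_le_sub_one_of_pos (show 0 < 1 - μs + ε by linarith)
    rw [one_div (1 - μs + ε), Real.log_inv, one_div, ← div_eq_inv_mul,
      one_le_div (by positivity)]
    nlinarith
  have hterm := mul_le_mul_of_nonneg_right hfactor hsum
  rcases hT.eq_or_lt with rfl | hT1
  · -- `k₀ = 0` when `T = 1`, but at most one pull has taken place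
    have h1 : ∫ ω, (KinfBandit.numPulls A a 1 ω : ℝ) ∂P ≤ ∫ _, (1 : ℝ) ∂P :=
      integral_mono_of_nonneg (Filter.Eventually.of_forall fun ω => Nat.cast_nonneg _)
        (integrable_const _)
        (Filter.Eventually.of_forall fun ω => Nat.cast_le_one.2 (KinfBandit.numPulls_le 1))
    rw [integral_const, probReal_univ, one_smul] at h1
    have h2 := KinfBandit.toReal_exp_neg_lt_one hΘ
    have h3 : 0 ≤ 1 / (1 - (EReal.exp (-(KinfBandit.bigTheta (ν a) μs c ε 1 : EReal))).toReal) :=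
      div_nonneg zero_le_one (by linarith)
    have h4 : 0 ≤ (1 + c) * Real.log (1 : ℕ) / K := by positivity
    linarith
  have hlogT1 : 0 < Real.log T := Real.log_pos (by exact_mod_cast hT1)
  have hk₀1 : 1 ≤ k₀ := Nat.ceil_pos.2 (by positivity)
  have hk₀lt : (k₀ : ℝ) < (1 + c) * Real.log T / K + 1 := Nat.ceil_lt_add_one (by positivity)
  have hmain := hgame.integral_numPulls_le hstrategy hνa hνs (q := μs - ε) (μs := μs) (γ := γ)
    (by linarith) (by linarith) hμs1 hε_pos (by linarith) hk₀1 (by rw [hγ]; ring) hΘ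
  have hmain' : ∫ ω, (KinfBandit.numPulls A a T ω : ℝ) ∂P ≤ k₀
      + 1 / (1 - (EReal.exp (-(KinfBandit.bigTheta (ν a) μs c ε T : EReal))).toReal)
      + ∑ k ∈ Finset.Icc 1 T,
          ((k : ℝ) + 1) ^ (ν astar).support.ncard * Real.exp (-(k : ℝ) * ε ^ 2) := hmain
  linarith
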